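/- All systems are finite-dimensional; a state is a positive semidefinite operator of unit trace, a channel is a completely positive trace-preserving map, a subchannel is a completely positive trace-nonincreasing map. For states $\rho,\sigma$ let $D_{\max}(\rho\|\sigma)=\log_2\inf\{\lambda\in\mathbb R:\rho\le\lambda\sigma\}$ (equal to $\infty$ if there is no such $\lambda$) and $D_\Omega(\rho\|\sigma)=D_{\max}(\rho\|\sigma)+D_{\max}(\sigma\|\rho)$. For a channel $\mathcal N_{A\to B}$ the projective mutual information is $$I_\Omega(\mathcal N)=\sup_{\rho_{RA}}\ \inf_{\sigma_B}\ D_\Omega\big((\mathrm{id}_R\otimes\mathcal N)[\rho_{RA}]\,\big\|\,\rho_R\otimes\sigma_B\big)\in[0,\infty],$$ where the supremum is over all systems $R$ and states $\rho_{RA}$ and the infimum is over all states $\sigma_B$. A pEA (postselected entanglement-assisted) protocol with message systems $M,\widehat M$ of dimension $d_M$ is a supermap $\Theta$ of the form $\Theta\{\mathcal N\}[\rho_M]=(\mathcal D_{BB'\to\widehat M}\circ\mathcal N_{A\to B}\circ\mathcal E_{MA'\to A})[\rho_M\otimes\gamma_{A'B'}]$ with a state $\gamma_{A'B'}$, a channel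 $\mathcal E$ and a subchannel $\mathcal D$. A superchannel $\Xi_{(A\to B)\to(M\to M')}$ is a linear supermap that sends completely positive maps to completely positive maps and channels to channels, also when it acts on one part of a bipartite map; it is nonsignalling-assisted (NA) if the bipartite channel $\widehat\Xi_{MB\to AM'}$ equivalent to it (obtained by making the output $A$ and the input $B$ of the channel slot external) satisfies $\mathrm{Tr}_A\,\widehat\Xi[\rho_M\otimes\sigma_B]=\mathrm{Tr}_A\,\widehat\Xi[\omega_M\otimes\sigma_B]$ for all states $\rho_M,\omega_M,\sigma_B$. A pNA (postselected nonsignalling-assisted) protocol is a supermap of the form $\Theta\{\mathcal N\}=\mathcal D_{\widehat MX\to\widehat M}\circ\Xi\{\mathcal N\}$ with an NA superchannel $\Xi_{(A\to B)\to(M\to\widehat MX)}$, $d_X=2$, and a subchannel $\mathcal D$. For $\mathsf T\in\{\mathrm{pEA},\mathrm{pNA}\}$, the one-shot $\varepsilon$-error classical capacity $C^\varepsilon_{\mathsf T}(\mathcal N)$ is the supremum of $\log_2 d_M$ over all $d_M\ge1$ and all protocols $\Theta\in\mathsf T$ with message dimension $d_M$ such that, with $\mathcal N'=\Theta\{\mathcal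 N\}$, the worst-case conditional error probability satisfies $$1-\min_{m\in[d_M]}\frac{\langle m|\mathcal N'[|m\rangle\langle m|]|m\rangle}{\mathrm{Tr}\,\mathcal N'[|m\rangle\langle m|]}\le\varepsilon$$ (a protocol with a vanishing denominator is not admitted). Theorem. Let $\mathcal N_{A\to B}$ be a quantum channel and let $\varepsilon\in(0,1)$. Then $$\log_2\left\lceil\sqrt{\frac{\varepsilon}{1-\varepsilon}2^{I_\Omega(\mathcal N)}+1}-1\right\rceil^2\le C^\varepsilon_{\mathrm{pEA}}(\mathcal N)\le C^\varepsilon_{\mathrm{pNA}}(\mathcal N)\le\log_2\left\lfloor\frac{\varepsilon}{1-\varepsilon}2^{I_\Omega(\mathcal N)}+1\right\rfloor,$$ where on the left the logarithm is taken of the square. If $I_\Omega(\mathcal N)=\infty$, all four quantities are $\infty$. -/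

import Mathlib

open scoped Matrix Kronecker ENNReal ComplexOrder

noncomputable section

namespace Postselected

/-- A linear map `𝔅_A → 𝔅_B`, for quantum systems with orthonormal bases indexed by `A`, `B`. -/
abbrev SuperOp (A B : Type*) := Matrix A A ℂ →ₗ[ℂ] Matrix B B ℂ

/-! ### States, channels, subchannels -/

/-- A quantum state: a positive semidefinite operator of unit trace. -/
def IsState {A : Type*} [Fintype A] (ρ : Matrix A A ℂ) : Prop :=
  ρ.PosSemidef ∧ ρ.trace = 1

/-- `id_R ⊗ N`. -/
def ampliate (R : Type*) {A B : Type*} (N : SuperOp A B) : SuperOp (R × A) (R × B) where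
  toFun X := Matrix.of fun p q => N (X.submatrix (Prod.mk p.1) (Prod.mk q.1)) p.2 q.2
  map_add' X Y := by
    ext p q
    simp [Matrix.submatrix_add]
  map_smul' c X := by
    ext p q
    simp [Matrix.submatrix_smul]

/-- Complete positivity: `id_R ⊗ N` preserves positive semidefiniteness for every finite-dimensional
reference system `R`. -/
def IsCP {A B : Type*} (N : SuperOp A B) : Prop :=
  ∀ (r : ℕ) (X : Matrix (Fin r × A) (Fin r × A) ℂ),
    X.PosSemidef → (ampliate (Fin r) N X).PosSemidef

/-- A quantum channel: completely positive and trace preserving. -/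
def IsChannel {A B : Type*} [Fintype A] [Fintype B] (N : SuperOp A B) : Prop :=
  IsCP N ∧ ∀ X, (N X).trace = X.trace

/-- A subchannel: completely positive and trace nonincreasing. -/
def IsSubchannel {A B : Type*} [Fintype A] [Fintype B] (N : SuperOp A B) : Prop :=
  IsCP N ∧ ∀ X : Matrix A A ℂ, X.PosSemidef → (N X).trace.re ≤ X.trace.re

/-- The partial trace over the first tensor factor. -/
def traceFst {A B : Type*} [Fintype A] (X : Matrix (A × B) (A × B) ℂ) : Matrix B B ℂ :=
  Matrix.of fun b b' => ∑ a, X (a, b) (a, b')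

/-- The partial trace over the second tensor factor. -/
def traceSnd {A B : Type*} [Fintype B] (X : Matrix (A × B) (A × B) ℂ) : Matrix A A ℂ :=
  Matrix.of fun a a' => ∑ b, X (a, b) (a', b)

/-! ### Entropic quantities -/

/-- The base-two logarithm on `[0, ∞]`, with `log₂ 0 = -∞` and `log₂ ∞ = ∞`. -/
def log2 (x : ℝ≥0∞) : EReal := ENNReal.log x / (Real.log 2 : ℝ)

/-- `2 ^ y` on `[-∞, ∞]`, with `2 ^ (-∞) = 0` and `2 ^ ∞ = ∞`. -/
def exp2 (y : EReal) : ℝ≥0∞ := EReal.exp (y * (Real.log 2 : ℝ))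

/-- The max-relative entropy `log₂ inf {l : ρ ≤ l σ}` of two states; it is `∞` if there is no
such `l`. -/
def Dmax {A : Type*} [Fintype A] (ρ σ : Matrix A A ℂ) : EReal :=
  log2 (⨅ (l : ℝ) (_ : (l • σ - ρ).PosSemidef), ENNReal.ofReal l)

/-- The Hilbert projective metric of two states. -/
def DOmega {A : Type*} [Fintype A] (ρ σ : Matrix A A ℂ) : EReal :=
  Dmax ρ σ + Dmax σ ρ

/-- The projective mutual information `I_Ω(A;B)_ρ` of a bipartite state. -/
def projectiveInfo {A B : Type*} [Fintype A] [Fintype B]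
    (ρ : Matrix (A × B) (A × B) ℂ) : EReal :=
  ⨅ (σ : Matrix B B ℂ) (_ : IsState σ), DOmega ρ (traceSnd ρ ⊗ₖ σ)

/-- The projective mutual information `I_Ω(N)` of a channel: the supremum of `I_Ω(R;B)` over all
reference systems `R` and all input states on `R ⊗ A`. -/
def channelProjectiveInfo {A B : Type*} [Fintype A] [Fintype B] (N : SuperOp A B) : EReal :=
  ⨆ (r : ℕ) (ρ : Matrix (Fin r × A) (Fin r × A) ℂ) (_ : IsState ρ),
    projectiveInfo (ampliate (Fin r) N ρ)

/-! ### Supermaps and superchannels -/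

/-- A linear transformation of maps `A → B` into maps `M → M'`. -/
abbrev Supermap (A B M M' : Type*) := SuperOp A B →ₗ[ℂ] SuperOp M M'

/-- The component `Z ↦ ⟨s| N(|r⟩⟨r'| ⊗ Z) |s'⟩` of a map `R ⊗ A → S ⊗ B`. -/
def component {R S A B : Type*} [DecidableEq R] (N : SuperOp (R × A) (S × B))
    (r r' : R) (s s' : S) : SuperOp A B where
  toFun Z := (N (Matrix.single r r' 1 ⊗ₖ Z)).submatrix (Prod.mk s) (Prod.mk s')
  map_add' X Y := by simp [Matrix.kronecker_add, Matrix.submatrix_add]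
  map_smul' c X := by simp [Matrix.kronecker_smul, Matrix.submatrix_smul]

/-- `id ⊗ Θ`: the action of a supermap on the `A → B` part of a bipartite map
`R ⊗ A → S ⊗ B`. -/
def Supermap.extend {A B M M' : Type*} (Θ : Supermap A B M M')
    {R S : Type*} [Fintype R] [DecidableEq R] (N : SuperOp (R × A) (S × B)) :
    SuperOp (R × M) (S × M') where
  toFun X := Matrix.of fun p q => ∑ r, ∑ r',
    Θ (component N r r' p.1 q.1) (X.submatrix (Prod.mk r) (Prod.mk r')) p.2 q.2
  map_add' X Y := by
    ext p q
    simp [Matrix.submatrix_add, Finset.sum_add_distrib]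
  map_smul' c X := by
    ext p q
    simp [Matrix.submatrix_smul, Finset.mul_sum]

/-- A (deterministic) superchannel: it maps completely positive maps to completely positive maps
and channels to channels, also when acting on one part of a bipartite map. -/
structure IsSuperchannel {A B M M' : Type*} [Fintype A] [Fintype B] [Fintype M] [Fintype M']
    (Θ : Supermap A B M M') : Prop where
  cp : ∀ (r s : ℕ) (N : SuperOp (Fin r × A) (Fin s × B)), IsCP N → IsCP (Θ.extend N)
  channel : ∀ (r s : ℕ) (N : SuperOp (Fin r × A) (Fin s × B)),
    IsChannel N → IsChannel (Θ.extend N)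

/-- The map `Z ↦ ⟨i|Z|j⟩ Y`. -/
def entryMap {A B : Type*} (i j : A) (Y : Matrix B B ℂ) : SuperOp A B where
  toFun Z := Z i j • Y
  map_add' X Z := by simp [add_smul]
  map_smul' c X := by simp [mul_smul]

/-- The bipartite map `M ⊗ B → A ⊗ M'` equivalent to a supermap `Θ`. It is the linear map with
`X ⊗ Y ↦ ∑ i j, |i⟩⟨j| ⊗ Θ{Z ↦ ⟨i|Z|j⟩ Y}[X]`. For `Θ{N} = D ∘ (N ⊗ id_E) ∘ E`, with `E : M → A ⊗ E`
and `D : B ⊗ E → M'`, it sends `X ⊗ Y` to `(id_A ⊗ D)(E[X] ⊗ Y)`: the channel slot is cut open,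
so that `A` becomes an output and `B` an input. -/
def Supermap.bipartite {A B M M' : Type*} [Fintype B] [DecidableEq B] [Fintype M] [DecidableEq M]
    (Θ : Supermap A B M M') : SuperOp (M × B) (A × M') where
  toFun W := Matrix.of fun p q => ∑ m, ∑ m', ∑ b, ∑ b', W (m, b) (m', b') *
    Θ (entryMap p.1 q.1 (Matrix.single b b' 1)) (Matrix.single m m' 1) p.2 q.2
  map_add' X Y := by
    ext p q
    simp [add_mul, Finset.sum_add_distrib]
  map_smul' c X := by
    ext p q
    simp [Finset.mul_sum, mul_assoc]

/-- A nonsignalling-assisted (NA) protocol: a superchannel whose bipartite channel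
`M ⊗ B → A ⊗ M'` is nonsignalling from Alice (`M`, `A`) to Bob (`B`, `M'`). -/
def IsNA {A B M M' : Type*} [Fintype A] [Fintype B] [DecidableEq B]
    [Fintype M] [DecidableEq M] [Fintype M'] (Ξ : Supermap A B M M') : Prop :=
  IsSuperchannel Ξ ∧ ∀ (ρ ω : Matrix M M ℂ) (σ : Matrix B B ℂ),
    IsState ρ → IsState ω → IsState σ →
      traceFst (Ξ.bipartite (ρ ⊗ₖ σ)) = traceFst (Ξ.bipartite (ω ⊗ₖ σ))

/-! ### Postselected protocols -/

/-- The operator `ρ_M ⊗ γ_{A'B'}`, with the tensor factors listed in the order `B', M, A'`. -/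
def withShared {M A' B' : Type*} (ρ : Matrix M M ℂ)
    (γ : Matrix (A' × B') (A' × B') ℂ) : Matrix (B' × M × A') (B' × M × A') ℂ :=
  (ρ ⊗ₖ γ).submatrix (fun x => (x.2.1, x.2.2, x.1)) (fun x => (x.2.1, x.2.2, x.1))

/-- The class of pEA protocols with messages of dimension `d`: for some shared state `γ` on
`A' ⊗ B'`, encoding channel `E : M ⊗ A' → A` and decoding subchannel `D : B' ⊗ B → M'`,
`Θ{N}[ρ] = D[(id ⊗ N)[(id ⊗ E)[ρ ⊗ γ]]]`. -/
def pEA (A B : Type*) [Fintype A] [Fintype B] (d : ℕ) :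
    Set (Supermap A B (Fin d) (Fin d)) :=
  {Θ | ∃ (a' b' : ℕ) (γ : Matrix (Fin a' × Fin b') (Fin a' × Fin b') ℂ)
      (E : SuperOp (Fin d × Fin a') A) (D : SuperOp (Fin b' × B) (Fin d)),
      IsState γ ∧ IsChannel E ∧ IsSubchannel D ∧
      ∀ (N : SuperOp A B) (ρ : Matrix (Fin d) (Fin d) ℂ),
        Θ N ρ = D (ampliate (Fin b') N (ampliate (Fin b') E (withShared ρ γ)))}

/-- The class of pNA protocols with messages of dimension `d`: an NA protocol
`(A → B) → (M → M' ⊗ X)` with a two-dimensional flag system `X`, followed by a subchannel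
`M' ⊗ X → M'` of Bob. -/
def pNA (A B : Type*) [Fintype A] [Fintype B] [DecidableEq B] (d : ℕ) :
    Set (Supermap A B (Fin d) (Fin d)) :=
  {Θ | ∃ (Ξ : Supermap A B (Fin d) (Fin d × Fin 2)) (D : SuperOp (Fin d × Fin 2) (Fin d)),
      IsNA Ξ ∧ IsSubchannel D ∧ ∀ N : SuperOp A B, Θ N = D ∘ₗ Ξ N}

/-- The worst-case conditional error probability of classical communication through the simulated
subchannel `N' = Θ{N}`. If some message has conclusive probability `0`, its quotient is `0 / 0 = 0`
and the error is `1`. -/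
def errC {d : ℕ} (N' : SuperOp (Fin d) (Fin d)) : ℝ :=
  1 - ⨅ m : Fin d, (Matrix.single m m 1 * N' (Matrix.single m m 1)).trace.re /
    (N' (Matrix.single m m 1)).trace.re

/-- The one-shot `ε`-error classical capacity of `N` assisted by a class `T` of protocols: the
supremum of `log₂ d` over all message dimensions `d ≥ 1` and all protocols in the class with
conditional error at most `ε`. -/
def classicalCapacity {A B : Type*} (T : ∀ d : ℕ, Set (Supermap A B (Fin d) (Fin d)))
    (ε : ℝ) (N : SuperOp A B) : EReal :=
  ⨆ (d : ℕ) (_ : 1 ≤ d) (Θ : Supermap A B (Fin d) (Fin d)) (_ : Θ ∈ T d)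
    (_ : errC (Θ N) ≤ ε), log2 d

end Postselected

end

noncomputable section

namespace Postselected

/-! ### Complete positivity -/

section CompletePositivity

variable {A B C R : Type*}

/-! Write Λ = 2 ^ I_Ω(N), and for T ≥ 0 on B ⊗ A let p(T) = ⟨Ω|(id ⊗ N)[T]|Ω⟩ (`pairing`).
Everything rests on a variational formula: Λ is the infimum of the l such that p(T₁) ≤ l p(T₂) for
all T₁, T₂ ≥ 0 with equal marginals on B. In one direction (`pairing_le`), T₁ and T₂ are placed in a
single input state with a classical flag, so one σ must serve both, and the two halves of D_Ω
compare p(T₁) and p(T₂) with the same number. In the other, conic duality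
(`exists_traceMap_between`) turns the ratio bound into an operator Y with N ≤ tr(·) Y ≤ l N in the
completely positive order, and Y / tr Y is then a good σ for every input
(`channelProjectiveInfo_le`).

Converse: ⟨k|Θ{N}[|m⟩⟨m|]|k⟩ equals p(T) for an operator T (`slotOperator`) that is positive because
superchannels preserve complete positivity, and whose marginal on B does not depend on m because the
protocol is nonsignalling. So the weight of outcome k under message k exceeds its weight under any
other message by at most the factor Λ. Summation with the error condition gives (d - 1)(1 - ε) ≤ ε Λ
(`dim_le_of_mem_pNA`).

Achievability: for l < Λ a pair violating the ratio bound becomes, after filtering by the common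
marginal, two channels B → A and a rank-one test with likelihood ratio above l (`exists_encoders`).
Alice and Bob share a uniformly random guess g and a maximally entangled state; Alice applies the
first channel if g is her message and the second otherwise, and Bob returns g when the test passes.
Every d < ε/(1 - ε) Λ + 1 is reached this way (`exists_mem_pEA`), in particular the square in the
lower bound when it is finite and nonzero.

The middle inequality holds because a decoding subchannel can be completed to a channel with a
failure flag (`pEA_subset_pNA`). -/

lemma ampliate_apply (N : SuperOp A B) (X : Matrix (R × A) (R × A) ℂ) (p q : R × B) :
    ampliate R N X p q = N (X.submatrix (Prod.mk p.1) (Prod.mk q.1)) p.2 q.2 := rfl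

lemma IsCP.ampliate_posSemidef [Finite R] {N : SuperOp A B} (hN : IsCP N)
    {X : Matrix (R × A) (R × A) ℂ} (hX : X.PosSemidef) : (ampliate R N X).PosSemidef := by
  obtain ⟨r, ⟨e⟩⟩ := Finite.exists_equiv_fin R
  have h := (hN r _ (hX.submatrix (Prod.map e.symm id))).submatrix (Prod.map e id)
  have hX' : (ampliate (Fin r) N (X.submatrix (Prod.map e.symm id) (Prod.map e.symm id))).submatrix
      (Prod.map e id) (Prod.map e id) = ampliate R N X := by
    ext p q
    simp only [ampliate_apply, Matrix.submatrix_apply, Prod.map_fst, Prod.map_snd, id,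
      Matrix.submatrix_submatrix, Function.comp_def, Prod.map_apply, e.symm_apply_apply]
  exact hX' ▸ h

lemma IsCP.posSemidef {N : SuperOp A B} (hN : IsCP N) {X : Matrix A A ℂ} (hX : X.PosSemidef) :
    (N X).PosSemidef := by
  exact (hN.ampliate_posSemidef (R := Unit) (hX.submatrix Prod.snd)).submatrix
    (fun b : B => ((), b))

lemma IsCP.comp {N : SuperOp A B} {N' : SuperOp B C} (hN' : IsCP N') (hN : IsCP N) :
    IsCP (N' ∘ₗ N) := fun r X hX => hN' r _ (hN r X hX)

lemma IsCP.add {N N' : SuperOp A B} (hN : IsCP N) (hN' : IsCP N') : IsCP (N + N') :=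
  fun r X hX => (hN r X hX).add (hN' r X hX)

lemma IsCP.sum {ι : Type*} {s : Finset ι} {N : ι → SuperOp A B} (hN : ∀ i ∈ s, IsCP (N i)) :
    IsCP (∑ i ∈ s, N i) := by
  intro r X hX
  convert Matrix.posSemidef_sum s fun i hi => hN i hi r X hX using 1
  ext p q
  simp [ampliate_apply, Matrix.sum_apply]

lemma IsCP.smul {N : SuperOp A B} (hN : IsCP N) {c : ℂ} (hc : 0 ≤ c) : IsCP (c • N) :=
  fun r X hX => (hN r X hX).smul hc

lemma IsCP.ampliate [Finite R] {N : SuperOp A B} (hN : IsCP N) : IsCP (ampliate R N) := by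
  intro r X hX
  exact (hN.ampliate_posSemidef (R := Fin r × R)
    (hX.submatrix fun p : (Fin r × R) × A => (p.1.1, p.1.2, p.2))).submatrix
    fun p : Fin r × R × B => ((p.1, p.2.1), p.2.2)

/-- Reindexing (or compression to a subset of) the basis, as a map of operators. -/
def submatrixMap (f : B → A) : SuperOp A B where
  toFun X := X.submatrix f f
  map_add' _ _ := rfl
  map_smul' _ _ := rfl

@[simp] lemma submatrixMap_apply (f : B → A) (X : Matrix A A ℂ) :
    submatrixMap f X = X.submatrix f f := rfl

lemma isCP_submatrixMap (f : B → A) : IsCP (submatrixMap f) :=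
  fun _ _ hX => hX.submatrix (Prod.map id f)

/-- `X ↦ X ⊗ Y`. -/
def kroneckerRight (A : Type*) (Y : Matrix B B ℂ) : SuperOp A (A × B) where
  toFun X := X ⊗ₖ Y
  map_add' _ _ := Matrix.add_kronecker ..
  map_smul' _ _ := Matrix.smul_kronecker ..

@[simp] lemma kroneckerRight_apply (Y : Matrix B B ℂ) (X : Matrix A A ℂ) :
    kroneckerRight A Y X = X ⊗ₖ Y := rfl

lemma isCP_kroneckerRight [Finite A] [Finite B] {Y : Matrix B B ℂ} (hY : Y.PosSemidef) :
    IsCP (kroneckerRight A Y) := by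
  intro r X hX
  exact (hX.kronecker hY).submatrix fun p : Fin r × A × B => ((p.1, p.2.1), p.2.2)

lemma superOp_eq_sum [Fintype A] [DecidableEq A] (N : SuperOp A B) (X : Matrix A A ℂ) :
    N X = ∑ a, ∑ a', X a a' • N (Matrix.single a a' 1) := by
  conv_lhs => rw [Matrix.matrix_eq_sum_single X]
  simp only [map_sum, ← map_smul, Matrix.smul_single, smul_eq_mul, mul_one]

/-- The Choi matrix. -/
def choi [DecidableEq A] (N : SuperOp A B) : Matrix (A × B) (A × B) ℂ :=
  Matrix.of fun p q => N (Matrix.single p.1 q.1 1) p.2 q.2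

/-- This is congruence by (column of ones) ⊗ 1_B. -/
lemma _root_.Matrix.PosSemidef.sum_blocks [Fintype A] [Finite B] {M : Matrix (A × B) (A × B) ℂ}
    (hM : M.PosSemidef) :
    (Matrix.of fun b b' => ∑ a, ∑ a', M (a, b) (a', b')).PosSemidef := by
  classical
  have := Fintype.ofFinite B
  have h := hM.conjTranspose_mul_mul_same
    (Matrix.of fun (p : A × B) (b : B) => if p.2 = b then (1 : ℂ) else 0)
  have h' : (Matrix.of fun (p : A × B) (b : B) => if p.2 = b then (1 : ℂ) else 0)ᴴ * M *
      (Matrix.of fun (p : A × B) (b : B) => if p.2 = b then (1 : ℂ) else 0) =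
      Matrix.of fun b b' => ∑ a, ∑ a', M (a, b) (a', b') := by
    ext b b'
    simp only [Matrix.mul_apply, Matrix.conjTranspose_apply, Matrix.of_apply,
      Fintype.sum_prod_type, apply_ite star, star_one, star_zero, mul_ite, ite_mul, mul_one, one_mul,
      mul_zero, zero_mul, Finset.sum_ite_eq', Finset.mem_univ, if_true]
    exact Finset.sum_comm
  exact h' ▸ h

/-- By linearity, `ampliate (Fin r) N X` is X ⊗ `choi N` restricted to the entries where both copies
of the `A` index agree, followed by summation of the blocks; both operations preserve positivity. -/
lemma isCP_of_choi [Fintype A] [DecidableEq A] [Finite B] {N : SuperOp A B}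
    (hN : (choi N).PosSemidef) : IsCP N := by
  intro r X hX
  have h := ((hX.kronecker hN).submatrix
    fun p : A × Fin r × B => ((p.2.1, p.1), (p.1, p.2.2))).sum_blocks
  have h' : ampliate (Fin r) N X = Matrix.of fun b b' => ∑ a, ∑ a',
      ((X ⊗ₖ choi N).submatrix (fun p : A × Fin r × B => ((p.2.1, p.1), (p.1, p.2.2)))
        fun p : A × Fin r × B => ((p.2.1, p.1), (p.1, p.2.2))) (a, b) (a', b') := by
    ext p q
    rw [ampliate_apply, superOp_eq_sum]
    simp [Matrix.sum_apply, choi]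
  exact h' ▸ h

/-- The Choi matrix is the image of the unnormalized maximally entangled projector on A ⊗ A. -/
lemma IsCP.choi_posSemidef [Fintype A] [DecidableEq A] {N : SuperOp A B} (hN : IsCP N) :
    (choi N).PosSemidef := by
  have h := hN.ampliate_posSemidef (R := A) (Matrix.posSemidef_vecMulVec_self_star
    fun p : A × A => if p.1 = p.2 then (1 : ℂ) else 0)
  have h' : Postselected.ampliate A N (Matrix.vecMulVec (fun p : A × A => if p.1 = p.2 then (1 : ℂ) else 0)
      (star fun p : A × A => if p.1 = p.2 then (1 : ℂ) else 0)) = choi N := by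
    ext p q
    simp only [ampliate_apply, choi, Matrix.of_apply]
    refine congrArg (fun Y => N Y p.2 q.2) ?_
    ext a a'
    by_cases h₁ : p.1 = a <;> by_cases h₂ : q.1 = a' <;>
      simp [Matrix.vecMulVec_apply, h₁, h₂]
  exact h' ▸ h

/-! ### Trace preservation and tensor products with the identity -/

lemma trace_ampliate [Fintype A] [Fintype B] [Fintype R] (N : SuperOp A B)
    (hN : ∀ X, (N X).trace = X.trace) (X : Matrix (R × A) (R × A) ℂ) :
    (ampliate R N X).trace = X.trace := by
  simp only [Matrix.trace, Matrix.diag_apply, Fintype.sum_prod_type, ampliate_apply] at hN ⊢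
  exact Finset.sum_congr rfl fun r _ => hN _

lemma traceSnd_ampliate [Fintype A] [Fintype B] (N : SuperOp A B)
    (hN : ∀ X, (N X).trace = X.trace) (X : Matrix (R × A) (R × A) ℂ) :
    traceSnd (ampliate R N X) = traceSnd X := by
  ext r r'
  exact hN (X.submatrix (Prod.mk r) (Prod.mk r'))

lemma trace_traceSnd [Fintype A] [Fintype B] (X : Matrix (A × B) (A × B) ℂ) :
    (traceSnd X).trace = X.trace := by
  simp [Matrix.trace, traceSnd, Fintype.sum_prod_type]

lemma IsChannel.ampliate [Fintype A] [Fintype B] [Fintype R] {N : SuperOp A B} (hN : IsChannel N) :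
    IsChannel (ampliate R N) :=
  ⟨hN.1.ampliate, trace_ampliate N hN.2⟩

lemma IsChannel.comp [Fintype A] [Fintype B] [Fintype C] {N : SuperOp A B} {N' : SuperOp B C}
    (hN' : IsChannel N') (hN : IsChannel N) : IsChannel (N' ∘ₗ N) :=
  ⟨hN'.1.comp hN.1, fun X => (hN'.2 _).trans (hN.2 X)⟩

lemma isChannel_submatrixMap [Fintype A] [Fintype B] (e : B ≃ A) :
    IsChannel (submatrixMap (e : B → A)) :=
  ⟨isCP_submatrixMap _, fun X => Equiv.sum_comp e fun a => X a a⟩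

lemma _root_.Matrix.PosSemidef.traceSnd [Finite A] [Fintype B] {X : Matrix (A × B) (A × B) ℂ}
    (hX : X.PosSemidef) : (traceSnd X).PosSemidef := by
  have h : Postselected.traceSnd X = ∑ b, X.submatrix (fun a => (a, b)) (fun a => (a, b)) := by
    ext a a'
    simp [Postselected.traceSnd, Matrix.sum_apply]
  rw [h]
  exact Matrix.posSemidef_sum _ fun b _ => hX.submatrix _

end CompletePositivity

/-! ### The pairing of a map with operators, and its duality -/

section Duality

variable {A B : Type*}

/-- For Hermitian T both iT and -iT have Hermitian part zero, so the hypothesis forces `c T` to be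
real; this makes the matrix Hermitian. Its quadratic form is the value of `c` on rank-one
projectors. The lemma turns real functionals found by conic duality into Choi matrices. -/
lemma posSemidef_of_functional {n : Type*} [Fintype n] [DecidableEq n]
    (c : Matrix n n ℂ →ₗ[ℂ] ℂ) (hc : ∀ T : Matrix n n ℂ, (T + Tᴴ).PosSemidef → 0 ≤ (c T).re) :
    (Matrix.of fun p q => c (Matrix.single p q 1)).PosSemidef := by
  have him : ∀ T : Matrix n n ℂ, T.IsHermitian → (c T).im = 0 := by
    intro T hT
    have h₁ := hc (Complex.I • T) (by
      rw [Matrix.conjTranspose_smul, hT.eq]; simp [Matrix.PosSemidef.zero])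
    have h₂ := hc (-(Complex.I • T)) (by
      rw [Matrix.conjTranspose_neg, Matrix.conjTranspose_smul, hT.eq]
      simp [Matrix.PosSemidef.zero])
    rw [map_neg, map_smul] at h₂
    rw [map_smul] at h₁
    simp at h₁ h₂
    linarith
  refine Matrix.PosSemidef.of_dotProduct_mulVec_nonneg ?_ fun x => ?_
  · ext p q
    have h₁ := him (Matrix.single p q 1 + Matrix.single q p 1) (by
      rw [Matrix.IsHermitian, Matrix.conjTranspose_add]; simp [add_comm])
    have h₂ := him (Complex.I • (Matrix.single p q 1 - Matrix.single q p 1)) (by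
      rw [Matrix.IsHermitian, Matrix.conjTranspose_smul, Matrix.conjTranspose_sub]
      simp [smul_sub, neg_add_eq_sub])
    rw [map_add] at h₁
    rw [map_smul, map_sub] at h₂
    simp at h₁ h₂
    apply Complex.ext <;> simp <;> linarith
  · have hx := Matrix.posSemidef_vecMulVec_self_star (star x)
    have key : star x ⬝ᵥ (Matrix.of fun p q => c (Matrix.single p q 1)) *ᵥ x =
        c (Matrix.vecMulVec (star x) (star (star x))) := by
      rw [Matrix.matrix_eq_sum_single (Matrix.vecMulVec (star x) (star (star x)))]
      simp only [map_sum, dotProduct, Matrix.mulVec, Finset.mul_sum]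
      refine Finset.sum_congr rfl fun p _ => Finset.sum_congr rfl fun q _ => ?_
      have : Matrix.single p q (Matrix.vecMulVec (star x) (star (star x)) p q) =
        (star x p * x q) • Matrix.single p q (1 : ℂ) := by
        simp [Matrix.smul_single, Matrix.vecMulVec_apply]
      rw [this, map_smul]
      simp
      ring
    rw [key, Complex.nonneg_iff]
    refine ⟨hc _ ?_, (him _ hx.isHermitian).symm⟩
    exact hx.add hx.conjTranspose

/-- `⟨Ω| (id ⊗ N)[T] |Ω⟩` for the unnormalized maximally entangled vector `Ω` on `B ⊗ B`. -/
def pairing [Fintype B] (N : SuperOp A B) : Matrix (B × A) (B × A) ℂ →ₗ[ℂ] ℂ where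
  toFun T := ∑ b, ∑ b', ampliate B N T (b, b) (b', b')
  map_add' X Y := by simp [Finset.sum_add_distrib]
  map_smul' c X := by simp [Finset.mul_sum]

lemma pairing_apply [Fintype B] (N : SuperOp A B) (T : Matrix (B × A) (B × A) ℂ) :
    pairing N T = ∑ b, ∑ b', ampliate B N T (b, b) (b', b') := rfl

lemma _root_.Matrix.PosSemidef.sum_sum_nonneg {n : Type*} [Fintype n] {M : Matrix n n ℂ}
    (hM : M.PosSemidef) : 0 ≤ ∑ i, ∑ j, M i j :=
  ((hM.submatrix fun p : n × Unit => p.1).sum_blocks).diag_nonneg (i := ())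

lemma sum_diag_nonneg [Fintype B] {M : Matrix (B × B) (B × B) ℂ} (hM : M.PosSemidef) :
    0 ≤ ∑ b, ∑ b', M (b, b) (b', b') :=
  (hM.submatrix fun b => (b, b)).sum_sum_nonneg

lemma pairing_nonneg [Fintype B] {N : SuperOp A B} (hN : IsCP N)
    {T : Matrix (B × A) (B × A) ℂ} (hT : T.PosSemidef) : 0 ≤ pairing N T :=
  sum_diag_nonneg (hN.ampliate_posSemidef hT)

lemma IsCP.map_conjTranspose [Fintype A] {N : SuperOp A B} (hN : IsCP N)
    (X : Matrix A A ℂ) : N Xᴴ = (N X)ᴴ := by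
  classical
  ext b b'
  rw [Matrix.conjTranspose_apply, superOp_eq_sum N Xᴴ, superOp_eq_sum N X]
  simp only [Matrix.sum_apply, Matrix.smul_apply, star_sum, smul_eq_mul, star_mul',
    Matrix.conjTranspose_apply]
  rw [Finset.sum_comm]
  refine Finset.sum_congr rfl fun a _ => Finset.sum_congr rfl fun a' _ => ?_
  congr 1
  exact (hN.choi_posSemidef.isHermitian.apply (a', b) (a, b')).symm

lemma pairing_conjTranspose [Fintype A] [Fintype B] {N : SuperOp A B} (hN : IsCP N)
    (T : Matrix (B × A) (B × A) ℂ) : pairing N Tᴴ = star (pairing N T) := by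
  simp only [pairing_apply, star_sum, ampliate_apply]
  rw [Finset.sum_comm]
  refine Finset.sum_congr rfl fun b _ => Finset.sum_congr rfl fun b' _ => ?_
  exact congrFun (congrFun (hN.map_conjTranspose (T.submatrix (Prod.mk b) (Prod.mk b'))) b') b

/-- `X ↦ tr(X) Y`. -/
def traceMap [Fintype A] (Y : Matrix B B ℂ) : SuperOp A B where
  toFun X := X.trace • Y
  map_add' _ _ := by rw [Matrix.trace_add, add_smul]
  map_smul' _ _ := by rw [Matrix.trace_smul, smul_assoc]; rfl

@[simp] lemma traceMap_apply [Fintype A] (Y : Matrix B B ℂ) (X : Matrix A A ℂ) :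
    traceMap Y X = X.trace • Y := rfl

lemma ampliate_traceMap {R : Type*} [Fintype A] (Y : Matrix B B ℂ)
    (X : Matrix (R × A) (R × A) ℂ) : ampliate R (traceMap Y) X = traceSnd X ⊗ₖ Y := rfl

lemma _root_.Matrix.IsHermitian.exists_posSemidef_add_smul_one {n : Type*} [Fintype n]
    [DecidableEq n] {H : Matrix n n ℂ} (hH : H.IsHermitian) :
    ∃ c : ℝ, ∀ c' : ℝ, c ≤ c' → (H + (c' : ℂ) • 1).PosSemidef := by
  refine ⟨∑ i, |hH.eigenvalues i|, fun c' hc => ?_⟩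
  have h₁ : H + (c' : ℂ) • 1 = Unitary.conjStarAlgAut ℂ _ hH.eigenvectorUnitary
      (Matrix.diagonal (fun i => ((hH.eigenvalues i + c' : ℝ) : ℂ))) := by
    have : (Matrix.diagonal (fun i => ((hH.eigenvalues i + c' : ℝ) : ℂ))) =
        Matrix.diagonal (RCLike.ofReal ∘ hH.eigenvalues) + (c' : ℂ) • (1 : Matrix n n ℂ) := by
      rw [Matrix.smul_one_eq_diagonal, Matrix.diagonal_add]
      simp
    rw [this, map_add, map_smul, map_one, ← hH.spectral_theorem]
  rw [h₁, Unitary.conjStarAlgAut_apply]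
  refine Matrix.PosSemidef.mul_mul_conjTranspose_same (Matrix.PosSemidef.diagonal fun i => ?_) _
  simp only [Pi.zero_apply, Complex.zero_le_real]
  have h₂ := Finset.single_le_sum (f := fun i => |hH.eigenvalues i|) (fun i _ => abs_nonneg _)
    (Finset.mem_univ i)
  have h₃ := neg_abs_le (hH.eigenvalues i)
  linarith

/-- The operators whose Hermitian part is positive semidefinite. -/
def hermitianPartCone (n : Type*) : PointedCone ℝ (Matrix n n ℂ) where
  carrier := {X | (X + Xᴴ).PosSemidef}
  add_mem' {X Y} hX hY := by
    have := hX.add hY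
    rwa [add_add_add_comm, ← Matrix.conjTranspose_add] at this
  zero_mem' := by simp [Matrix.PosSemidef.zero]
  smul_mem' := by
    rintro ⟨c, hc⟩ X hX
    have := hX.smul hc
    have hstar : (c • X)ᴴ = c • Xᴴ := by
      rw [Matrix.conjTranspose_smul, star_trivial]
    rw [smul_add, ← hstar] at this
    exact this

lemma mem_hermitianPartCone {n : Type*} {X : Matrix n n ℂ} :
    X ∈ hermitianPartCone n ↔ (X + Xᴴ).PosSemidef := Iff.rfl

/-- The partial trace over the second tensor factor, as a linear map. -/
def traceSndLinear (A B : Type*) [Fintype B] : Matrix (A × B) (A × B) ℂ →ₗ[ℂ] Matrix A A ℂ where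
  toFun := traceSnd
  map_add' X Y := by ext; simp [traceSnd, Finset.sum_add_distrib]
  map_smul' c X := by ext; simp [traceSnd, Finset.mul_sum]

@[simp] lemma traceSndLinear_apply [Fintype B] (X : Matrix (A × B) (A × B) ℂ) :
    traceSndLinear A B X = traceSnd X := rfl

lemma traceSnd_conjTranspose [Fintype B] (X : Matrix (A × B) (A × B) ℂ) :
    traceSnd Xᴴ = (traceSnd X)ᴴ := by
  ext; simp [traceSnd]

lemma traceSnd_single [Fintype B] [DecidableEq A] [DecidableEq B] (a a' : A) (b b' : B) :
    traceSnd (Matrix.single (a, b) (a', b') (1 : ℂ)) =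
      if b = b' then Matrix.single a a' 1 else 0 := by
  ext i j
  by_cases h : b = b'
  · subst h
    by_cases h₁ : a = i <;> by_cases h₂ : a' = j <;>
      simp [traceSnd, Matrix.single_apply, h₁, h₂, Finset.filter_eq]
  · rw [if_neg h]
    refine Finset.sum_eq_zero fun x _ => ?_
    rw [Matrix.single_apply, if_neg]
    simp only [Prod.mk.injEq]
    rintro ⟨⟨-, rfl⟩, -, rfl⟩
    exact h rfl

/-- The pairing functional and the Choi matrix of `N` carry the same data, up to the order of the
tensor factors; hence positivity of functionals on B ⊗ A translates into complete positivity. -/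
lemma pairing_single [Fintype B] [DecidableEq A] [DecidableEq B] (N : SuperOp A B)
    (a a' : A) (b b' : B) :
    pairing N (Matrix.single (b, a) (b', a') 1) = N (Matrix.single a a' 1) b b' := by
  rw [pairing_apply, Finset.sum_eq_single b, Finset.sum_eq_single b']
  · rw [ampliate_apply]
    refine congrArg (fun Y => N Y b b') ?_
    ext i j
    simp [Matrix.single_apply]
  · intro c' _ hc
    have : (Matrix.single (b, a) (b', a') (1 : ℂ)).submatrix (Prod.mk b) (Prod.mk c') = 0 := by
      ext i j
      simp [hc.symm]
    simp [ampliate_apply, this]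
  · simp
  · intro c _ hc
    refine Finset.sum_eq_zero fun c' _ => ?_
    have : (Matrix.single (b, a) (b', a') (1 : ℂ)).submatrix (Prod.mk c) (Prod.mk c') = 0 := by
      ext i j
      simp [hc.symm]
    simp [ampliate_apply, this]
  · simp

/-- Conic duality: if the pairings of a completely positive map `N` with two positive operators of
equal marginals differ at most by the factor `l`, then `N ≤ tr(·) Y ≤ l N` for some `Y`. -/
lemma exists_traceMap_between [Fintype A] [Fintype B] {N : SuperOp A B} (hN : IsCP N) (l : ℝ)
    (h : ∀ T₁ T₂ : Matrix (B × A) (B × A) ℂ, T₁.PosSemidef → T₂.PosSemidef →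
      traceSnd T₁ = traceSnd T₂ → (pairing N T₁).re ≤ l * (pairing N T₂).re) :
    ∃ Y : Matrix B B ℂ, IsCP (traceMap Y - N) ∧ IsCP ((l : ℂ) • N - traceMap Y) := by
  classical
  let tr : Matrix (B × A) (B × A) ℂ →ₗ[ℝ] Matrix B B ℂ := (traceSndLinear B A).restrictScalars ℝ
  let φ := tr ∘ₗ LinearMap.fst ℝ _ _ - tr ∘ₗ LinearMap.snd ℝ _ _
  let pr : Matrix (B × A) (B × A) ℂ →ₗ[ℝ] ℝ := Complex.reLm ∘ₗ ((pairing N).restrictScalars ℝ)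
  let F := l • (pr ∘ₗ LinearMap.snd ℝ _ _) - pr ∘ₗ LinearMap.fst ℝ _ _
  have hφ : ∀ p, φ p = traceSnd p.1 - traceSnd p.2 := fun _ => rfl
  have hF : ∀ p, F p = l * (pairing N p.2).re - (pairing N p.1).re := fun _ => rfl
  have hre : ∀ T, (pairing N (T + Tᴴ)).re = 2 * (pairing N T).re := fun T => by
    rw [map_add, pairing_conjTranspose hN]; simp [two_mul]
  -- On the pairs with equal marginals, `F` is nonnegative on the cone by hypothesis. Adding a large
  -- multiple of (1, 1), which has equal marginals, moves any pair into the cone, so `F` extends to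
  -- a functional `g` that is nonnegative on the whole cone.
  obtain ⟨g, hg, hgs⟩ := riesz_extension
    ((hermitianPartCone (B × A)).prod (hermitianPartCone (B × A)))
    ⟨LinearMap.ker φ, F.domRestrict _⟩ (by
      rintro ⟨⟨T₁, T₂⟩, hT⟩ ⟨h₁, h₂⟩
      have hT' : traceSnd T₁ = traceSnd T₂ := by
        rw [LinearMap.mem_ker, hφ] at hT
        exact sub_eq_zero.mp hT
      have := h _ _ (mem_hermitianPartCone.1 h₁) (mem_hermitianPartCone.1 h₂) (by
        rw [← traceSndLinear_apply, ← traceSndLinear_apply, map_add, map_add]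
        simp only [traceSndLinear_apply, traceSnd_conjTranspose, hT'])
      rw [hre, hre] at this
      change 0 ≤ F (T₁, T₂)
      rw [hF]
      linarith) (by
      rintro ⟨T₁, T₂⟩
      obtain ⟨c₁, hc₁⟩ := (Matrix.isHermitian_add_transpose_self T₁).exists_posSemidef_add_smul_one
      obtain ⟨c₂, hc₂⟩ := (Matrix.isHermitian_add_transpose_self T₂).exists_posSemidef_add_smul_one
      let c := max c₁ c₂
      have hmem : ∀ T : Matrix (B × A) (B × A) ℂ, (T + Tᴴ + (c : ℂ) • 1).PosSemidef →
          ((c / 2 : ℝ) : ℂ) • 1 + T ∈ hermitianPartCone (B × A) := fun T hT => by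
        rw [mem_hermitianPartCone]
        convert hT using 1
        rw [Matrix.conjTranspose_add, Matrix.conjTranspose_smul, Matrix.conjTranspose_one,
          add_add_add_comm, ← add_smul, add_comm]
        congr 2
        simp
      refine ⟨⟨(((c / 2 : ℝ) : ℂ) • 1, ((c / 2 : ℝ) : ℂ) • 1), ?_⟩,
        hmem _ (hc₁ _ (le_max_left _ _)), hmem _ (hc₂ _ (le_max_right _ _))⟩
      rw [LinearMap.mem_ker, hφ, sub_self])
  -- `g - F` vanishes on `ker φ`, hence factors through the difference of marginals; `k` is the
  -- Lagrange multiplier of the marginal constraint, and its complexification `kc` is represented by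
  -- `Y`.
  obtain ⟨k, hk⟩ : ∃ k : Module.Dual ℝ (Matrix B B ℂ), g - F = k ∘ₗ φ := by
    have : g - F ∈ LinearMap.range φ.dualMap := by
      rw [LinearMap.range_dualMap_eq_dualAnnihilator_ker, Submodule.mem_dualAnnihilator]
      intro w hw
      rw [LinearMap.sub_apply, sub_eq_zero]
      exact hg ⟨w, hw⟩
    obtain ⟨k, hk⟩ := this
    exact ⟨k, hk.symm⟩
  have hg' : ∀ p, g p = F p + k (φ p) := fun p => by
    rw [← LinearMap.comp_apply k, ← hk]; simp
  have hzero : (0 : Matrix (B × A) (B × A) ℂ) ∈ hermitianPartCone (B × A) := Submodule.zero_mem _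
  let kc : Matrix B B ℂ →ₗ[ℂ] ℂ := Module.Dual.extendRCLike k
  have hkc : ∀ X, (kc X).re = k X := fun X => Module.Dual.re_extendRCLike_apply (𝕜 := ℂ) k X
  let Y : Matrix B B ℂ := Matrix.of fun b b' => kc (Matrix.single b b' 1)
  have hkcY : ∀ (a a' : A) (b b' : B), kc (traceSnd (Matrix.single (b, a) (b', a') (1 : ℂ))) =
      (traceMap Y (Matrix.single a a' 1) : Matrix B B ℂ) b b' := fun a a' b b' => by
    rw [traceSnd_single]
    by_cases haa : a = a'
    · subst haa; simp [Y]
    · simp [haa, Matrix.trace_single_eq_of_ne]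
  -- Positivity of `g` at (T, 0) gives tr(·) Y ≥ N, and at (0, T) below it gives l N ≥ tr(·) Y.
  have h₁ := posSemidef_of_functional (kc ∘ₗ traceSndLinear B A - pairing N) fun T hT => by
    have := hgs (T, 0) ⟨hT, hzero⟩
    rw [hg', hF, hφ, ← traceSndLinear_apply 0, map_zero, map_zero] at this
    simp [hkc] at this ⊢
    linarith
  have h₂ := posSemidef_of_functional ((l : ℂ) • pairing N - kc ∘ₗ traceSndLinear B A) fun T hT => by
    have := hgs (0, T) ⟨hzero, hT⟩
    rw [hg', hF, hφ, ← traceSndLinear_apply 0, map_zero, map_zero] at this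
    simp [hkc] at this ⊢
    linarith
  refine ⟨Y, isCP_of_choi ?_, isCP_of_choi ?_⟩
  · convert h₁.submatrix (Prod.swap : A × B → B × A) using 1
    ext ⟨a, b⟩ ⟨a', b'⟩
    change _ = kc (traceSnd (Matrix.single (b, a) (b', a') (1 : ℂ))) -
      pairing N (Matrix.single (b, a) (b', a') 1)
    rw [hkcY, pairing_single]
    rfl
  · convert h₂.submatrix (Prod.swap : A × B → B × A) using 1
    ext ⟨a, b⟩ ⟨a', b'⟩
    change _ = (l : ℂ) * pairing N (Matrix.single (b, a) (b', a') 1) -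
      kc (traceSnd (Matrix.single (b, a) (b', a') (1 : ℂ)))
    rw [hkcY, pairing_single]
    rfl

end Duality

/-! ### Logarithms -/

lemma exp2_log2 (x : ℝ≥0∞) : exp2 (log2 x) = x := by
  have h : Real.log 2 ≠ 0 := (Real.log_pos one_lt_two).ne'
  rw [exp2, log2, EReal.div_mul_cancel (EReal.coe_ne_bot _) (EReal.coe_ne_top _)
    (by exact_mod_cast h), ENNReal.exp_log]

lemma log2_exp2 (y : EReal) : log2 (exp2 y) = y := by
  have h : Real.log 2 ≠ 0 := (Real.log_pos one_lt_two).ne'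
  rw [exp2, log2, EReal.log_exp, mul_comm, ← EReal.mul_div, EReal.mul_div_cancel
    (EReal.coe_ne_bot _) (EReal.coe_ne_top _) (by exact_mod_cast h)]

lemma log2_mono : Monotone log2 := fun _ _ h =>
  EReal.div_le_div_right_of_nonneg (by exact_mod_cast (Real.log_pos one_lt_two).le)
    (ENNReal.log_monotone h)

lemma log2_strictMono : StrictMono log2 :=
  log2_mono.strictMono_of_injective fun x y h => by rw [← exp2_log2 x, h, exp2_log2]

lemma exp2_mono : Monotone exp2 := fun x y h => by
  rwa [← log2_strictMono.le_iff_le, log2_exp2, log2_exp2]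

lemma log2_mul (x y : ℝ≥0∞) : log2 (x * y) = log2 x + log2 y := by
  rw [log2, ENNReal.log_mul_add, EReal.add_div_of_nonneg_right]
  · rfl
  · exact_mod_cast (Real.log_pos one_lt_two).le

/-! ### The Hilbert metric and operator inequalities -/

section Entropy

variable {A B R : Type*}

lemma IsState.kronecker [Fintype A] [Fintype B] {ρ : Matrix A A ℂ} {σ : Matrix B B ℂ}
    (hρ : IsState ρ) (hσ : IsState σ) : IsState (ρ ⊗ₖ σ) :=
  ⟨hρ.1.kronecker hσ.1, by rw [Matrix.trace_kronecker, hρ.2, hσ.2, one_mul]⟩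

lemma IsState.traceSnd [Fintype A] [Fintype B] {ρ : Matrix (A × B) (A × B) ℂ}
    (hρ : IsState ρ) : IsState (traceSnd ρ) :=
  ⟨hρ.1.traceSnd, (trace_traceSnd ρ).trans hρ.2⟩

lemma IsState.ampliate [Fintype A] [Fintype B] [Fintype R] {N : SuperOp A B} (hN : IsChannel N)
    {ρ : Matrix (R × A) (R × A) ℂ} (hρ : IsState ρ) : IsState (ampliate R N ρ) :=
  ⟨hN.1.ampliate_posSemidef hρ.1, (trace_ampliate N hN.2 ρ).trans hρ.2⟩

lemma IsState.one_le [Fintype A] {ρ σ : Matrix A A ℂ} (hρ : IsState ρ) (hσ : IsState σ) {l : ℝ}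
    (h : (l • σ - ρ).PosSemidef) : 1 ≤ l := by
  have := h.trace_nonneg
  rw [Matrix.trace_sub, Matrix.trace_smul, hρ.2, hσ.2, Complex.nonneg_iff] at this
  simpa using this.1

lemma DOmega_le [Fintype A] {ρ σ : Matrix A A ℂ} {l₁ l₂ : ℝ}
    (h₁ : (l₁ • σ - ρ).PosSemidef) (h₂ : (l₂ • ρ - σ).PosSemidef) :
    DOmega ρ σ ≤ log2 (ENNReal.ofReal l₁ * ENNReal.ofReal l₂) := by
  rw [log2_mul]
  exact add_le_add (log2_mono (iInf₂_le l₁ h₁)) (log2_mono (iInf₂_le l₂ h₂))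

/-- Both infima are at least 1, by taking traces, and the product bound makes the second finite; so
one can divide in [0, ∞] and choose near-optimal witnesses one after the other. -/
lemma exists_of_DOmega_lt [Fintype A] {ρ σ : Matrix A A ℂ} (hρ : IsState ρ) (hσ : IsState σ)
    {l : ℝ} (h : DOmega ρ σ < log2 (ENNReal.ofReal l)) :
    ∃ l₁ l₂ : ℝ, 1 ≤ l₁ ∧ 1 ≤ l₂ ∧ l₁ * l₂ < l ∧
      (l₁ • σ - ρ).PosSemidef ∧ (l₂ • ρ - σ).PosSemidef := by
  rw [DOmega, Dmax, Dmax, ← log2_mul, log2_strictMono.lt_iff_lt] at h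
  set x : ℝ≥0∞ := ⨅ (l : ℝ) (_ : (l • σ - ρ).PosSemidef), ENNReal.ofReal l with hx
  set y : ℝ≥0∞ := ⨅ (l : ℝ) (_ : (l • ρ - σ).PosSemidef), ENNReal.ofReal l with hy
  have hx1 : 1 ≤ x := le_iInf₂ fun l hl => ENNReal.one_le_ofReal.2 (hρ.one_le hσ hl)
  have hy1 : 1 ≤ y := le_iInf₂ fun l hl => ENNReal.one_le_ofReal.2 (hσ.one_le hρ hl)
  have hyt : y ≠ ⊤ := ne_top_of_lt ((le_mul_of_one_le_left bot_le hx1).trans_lt h)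
  have hy0 : y ≠ 0 := (zero_lt_one.trans_le hy1).ne'
  have hxl : x < ENNReal.ofReal l / y :=
    (ENNReal.lt_div_iff_mul_lt (Or.inl hy0) (Or.inl hyt)).2 h
  obtain ⟨l₁, hl₁, h₁⟩ := by simpa only [hx, iInf_lt_iff, exists_prop] using hxl
  have h1 := hρ.one_le hσ hl₁
  have hyl : y < ENNReal.ofReal l / ENNReal.ofReal l₁ := by
    rw [ENNReal.lt_div_iff_mul_lt (Or.inl hy0) (Or.inl hyt), mul_comm] at h₁
    exact (ENNReal.lt_div_iff_mul_lt (Or.inl (by simp; linarith)) (Or.inl (by simp))).2 h₁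
  obtain ⟨l₂, hl₂, h₂⟩ := by simpa only [hy, iInf_lt_iff, exists_prop] using hyl
  have h2 := hσ.one_le hρ hl₂
  refine ⟨l₁, l₂, h1, h2, ?_, hl₁, hl₂⟩
  rw [ENNReal.lt_div_iff_mul_lt (Or.inl (by simp; linarith)) (Or.inl (by simp)),
    ← ENNReal.ofReal_mul (by linarith), ENNReal.ofReal_lt_ofReal_iff_of_nonneg (by nlinarith)] at h₂
  linarith

lemma _root_.Matrix.PosSemidef.traceFst [Fintype A] [Finite B] {X : Matrix (A × B) (A × B) ℂ}
    (hX : X.PosSemidef) : (traceFst X).PosSemidef := by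
  have h : Postselected.traceFst X = ∑ a, X.submatrix (Prod.mk a) (Prod.mk a) := by
    ext b b'
    simp [Postselected.traceFst, Matrix.sum_apply]
  rw [h]
  exact Matrix.posSemidef_sum _ fun a _ => hX.submatrix _

lemma traceFst_kronecker [Fintype A] (X : Matrix A A ℂ) (Y : Matrix B B ℂ) :
    traceFst (X ⊗ₖ Y) = X.trace • Y := by
  ext b b'
  simp [traceFst, Matrix.trace, Finset.sum_mul]

/-- Applied to any input state, the two inequalities bound the output by ρ_R ⊗ Y from above and
below. Normalizing Y by its trace t costs t in one factor and gains it in the other, so the product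
stays l. -/
lemma channelProjectiveInfo_le [Fintype A] [Fintype B] {N : SuperOp A B} (hN : IsChannel N)
    {l : ℝ} {Y : Matrix B B ℂ} (h₁ : IsCP (traceMap Y - N))
    (h₂ : IsCP ((l : ℂ) • N - traceMap Y)) :
    channelProjectiveInfo N ≤ log2 (ENNReal.ofReal l) := by
  refine iSup_le fun r => iSup₂_le fun ρ hρ => ?_
  have hω := hρ.ampliate hN
  set ω := ampliate (Fin r) N ρ with hωdef
  have hmarg : traceSnd ω = traceSnd ρ := traceSnd_ampliate N hN.2 ρ
  have h₁' : (traceSnd ρ ⊗ₖ Y - ω).PosSemidef := h₁.ampliate_posSemidef hρ.1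
  have h₂' : ((l : ℂ) • ω - traceSnd ρ ⊗ₖ Y).PosSemidef := h₂.ampliate_posSemidef hρ.1
  have hY : Y.PosSemidef := by
    have h := (h₁'.add hω.1).traceFst
    rwa [sub_add_cancel, traceFst_kronecker, hρ.traceSnd.2, one_smul] at h
  have htr : 0 ≤ Y.trace - 1 := by
    have h := h₁'.trace_nonneg
    rwa [Matrix.trace_sub, Matrix.trace_kronecker, hρ.traceSnd.2, hω.2, one_mul] at h
  rw [Complex.nonneg_iff] at htr
  obtain ⟨t, ht⟩ : ∃ t : ℝ, Y.trace = t := ⟨Y.trace.re, by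
    apply Complex.ext
    · simp
    · have := htr.2
      simp at this ⊢
      exact this.symm⟩
  have ht1 : 1 ≤ t := by simpa [ht] using htr.1
  have ht0 : t ≠ 0 := by positivity
  have hσ : IsState (t⁻¹ • Y) :=
    ⟨hY.smul (by positivity), by rw [Matrix.trace_smul, ht]; simp [ht0]⟩
  refine (iInf₂_le _ hσ).trans ((DOmega_le (l₁ := t) (l₂ := l * t⁻¹) ?_ ?_).trans_eq ?_)
  · rw [hmarg, Matrix.kronecker_smul, smul_smul, mul_inv_cancel₀ ht0, one_smul]
    exact h₁'
  · rw [hmarg, Matrix.kronecker_smul, mul_comm, ← smul_smul, ← smul_sub]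
    exact h₂'.smul (by positivity)
  · rw [← ENNReal.ofReal_mul (by positivity), mul_left_comm, mul_inv_cancel₀ ht0, mul_one]

lemma posSemidef_blockDiag {ι n : Type*} [Finite ι] [DecidableEq ι] [Finite n]
    {T : ι → Matrix n n ℂ} (hT : ∀ i, (T i).PosSemidef) :
    (Matrix.of fun p q : ι × n => if p.1 = q.1 then T p.1 p.2 q.2 else 0).PosSemidef := by
  have := Fintype.ofFinite ι
  have heq : (Matrix.of fun p q : ι × n => if p.1 = q.1 then T p.1 p.2 q.2 else 0) =
      ∑ i, (Matrix.vecMulVec (Pi.single i (1 : ℂ)) (star (Pi.single i (1 : ℂ)))) ⊗ₖ (T i) := by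
    ext p q
    simp only [Matrix.of_apply, Matrix.sum_apply, Matrix.kroneckerMap_apply,
      Matrix.vecMulVec_apply, Pi.star_apply, Pi.single_apply]
    by_cases hpq : p.1 = q.1
    · simp [hpq]
    · rw [if_neg hpq]
      refine (Finset.sum_eq_zero fun i _ => ?_).symm
      by_cases hi : p.1 = i
      · simp [← hi, Ne.symm hpq]
      · simp [hi]
  rw [heq]
  exact Matrix.posSemidef_sum _ fun i _ =>
    (Matrix.posSemidef_vecMulVec_self_star (Pi.single i (1 : ℂ))).kronecker (hT i)

/-- Pairings with positive operators of equal marginals differ at most by the factor `2 ^ I(N)`. -/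
lemma pairing_le [Fintype A] [Fintype B] {N : SuperOp A B} (hN : IsChannel N) {l : ℝ}
    (hl : channelProjectiveInfo N < log2 (ENNReal.ofReal l))
    {T₁ T₂ : Matrix (B × A) (B × A) ℂ} (h₁ : T₁.PosSemidef) (h₂ : T₂.PosSemidef)
    (h : traceSnd T₁ = traceSnd T₂) : (pairing N T₁).re ≤ l * (pairing N T₂).re := by
  have htr : T₁.trace = T₂.trace := by rw [← trace_traceSnd, h, trace_traceSnd]
  obtain ⟨t, ht⟩ : ∃ t : ℝ, T₁.trace = t := ⟨T₁.trace.re, by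
    apply Complex.ext
    · simp
    · simpa using (Complex.nonneg_iff.1 h₁.trace_nonneg).2.symm⟩
  have ht0 : 0 ≤ t := by simpa [ht] using h₁.trace_nonneg
  rcases ht0.eq_or_lt with rfl | ht0
  · have e₁ : T₁ = 0 := h₁.trace_eq_zero_iff.1 (by simpa using ht)
    have e₂ : T₂ = 0 := h₂.trace_eq_zero_iff.1 (by simpa [htr] using ht)
    simp [e₁, e₂]
  let T : Fin 2 → Matrix (B × A) (B × A) ℂ := ![T₁, T₂]
  have hT : ∀ i, (T i).PosSemidef := by
    intro i; fin_cases i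
    exacts [h₁, h₂]
  have hTt : ∀ i, (T i).trace = t := by
    intro i; fin_cases i
    exacts [ht, htr ▸ ht]
  have hTm : ∀ i, traceSnd (T i) = traceSnd T₁ := by
    intro i; fin_cases i
    exacts [rfl, h.symm]
  obtain ⟨r, ⟨e⟩⟩ := Finite.exists_equiv_fin (Fin 2 × B)
  -- The flagged direct sum of T₁ and T₂, with reference system `Fin 2 × B`. Its reference marginal
  -- has the same block twice, since the marginals of T₁ and T₂ agree.
  let X : Matrix ((Fin 2 × B) × A) ((Fin 2 × B) × A) ℂ :=
    Matrix.of fun p q => if p.1.1 = q.1.1 then T p.1.1 (p.1.2, p.2) (q.1.2, q.2) else 0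
  have hX : X.PosSemidef := (posSemidef_blockDiag hT).submatrix
    fun p : (Fin 2 × B) × A => (p.1.1, (p.1.2, p.2))
  have hXt : X.trace = 2 * t := by
    simp only [X, Matrix.trace, Fintype.sum_prod_type, Matrix.diag_apply, Matrix.of_apply, if_true]
    simp only [Matrix.trace, Fintype.sum_prod_type, Matrix.diag_apply] at hTt
    simp [hTt, two_mul]
  let f : (Fin 2 × B) × A ≃ Fin r × A := e.prodCongr (Equiv.refl A)
  let c : ℝ := (2 * t)⁻¹
  have hc : 0 < c := by positivity
  let ρ : Matrix (Fin r × A) (Fin r × A) ℂ := c • X.submatrix f.symm f.symm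
  have hρ : IsState ρ := by
    refine ⟨(hX.submatrix _).smul hc.le, ?_⟩
    rw [Matrix.trace_smul, ← submatrixMap_apply, (isChannel_submatrixMap f.symm).2 X, hXt]
    simp only [c]
    rw [Complex.real_smul]
    push_cast
    field_simp
  have hlt : projectiveInfo (ampliate (Fin r) N ρ) < log2 (ENNReal.ofReal l) :=
    lt_of_le_of_lt (le_iSup_of_le r (le_iSup₂
      (f := fun ρ (_ : IsState ρ) => projectiveInfo (ampliate (Fin r) N ρ)) ρ hρ)) hl
  simp only [projectiveInfo, iInf_lt_iff] at hlt
  obtain ⟨σ, hσ, hlt⟩ := hlt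
  have hω := hρ.ampliate hN
  obtain ⟨l₁, l₂, hl₁, hl₂, hll, hp₁, hp₂⟩ :=
    exists_of_DOmega_lt hω (hω.traceSnd.kronecker hσ) hlt
  rw [traceSnd_ampliate N hN.2] at hp₁ hp₂
  have hblock : ∀ i b b', ampliate (Fin r) N ρ (e (i, b), b) (e (i, b'), b') =
      c • ampliate B N (T i) (b, b) (b', b') := by
    intro i b b'
    rw [ampliate_apply, ampliate_apply]
    have : ρ.submatrix (Prod.mk (e (i, b))) (Prod.mk (e (i, b'))) =
        (c : ℂ) • (T i).submatrix (Prod.mk b) (Prod.mk b') := by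
      ext a a'
      simp [ρ, X, f]
    simp only [this, map_smul]
    simp
  have hmarg : ∀ i b b', traceSnd ρ (e (i, b)) (e (i, b')) = c • traceSnd T₁ b b' := by
    intro i b b'
    rw [← hTm i]
    simp [traceSnd, ρ, X, f, Finset.mul_sum]
  -- The first operator inequality is tested with Ω on the block of T₁, the second on the block of
  -- T₂. The same number `s` appears in both, giving p(T₁) ≤ l₁ s and s ≤ l₂ p(T₂).
  have q₁ := (hp₁.submatrix fun b => (e (0, b), b)).sum_sum_nonneg
  have q₂ := (hp₂.submatrix fun b => (e (1, b), b)).sum_sum_nonneg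
  simp only [Matrix.submatrix_apply, Matrix.sub_apply, Matrix.smul_apply,
    Matrix.kroneckerMap_apply, hblock, hmarg] at q₁ q₂
  set s : ℂ := ∑ b, ∑ b', traceSnd T₁ b b' * σ b b' with hs
  have q₁' : (0 : ℂ) ≤ c • (l₁ • s - pairing N T₁) := by
    convert q₁ using 1
    simp only [hs, pairing_apply, Complex.real_smul, mul_sub, Finset.mul_sum,
      Finset.sum_sub_distrib, T, Matrix.cons_val_zero]
    congr! 3
    ring
  have q₂' : (0 : ℂ) ≤ c • (l₂ • pairing N T₂ - s) := by
    convert q₂ using 1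
    simp only [hs, pairing_apply, Complex.real_smul, mul_sub, Finset.mul_sum,
      Finset.sum_sub_distrib, T, Matrix.cons_val_one]
    congr! 3
    · exact mul_left_comm _ _ _
    · ring
  have q₁'' := (Complex.nonneg_iff.1 q₁').1
  have q₂'' := (Complex.nonneg_iff.1 q₂').1
  have hf₂ := (Complex.nonneg_iff.1 (pairing_nonneg hN.1 h₂)).1
  simp at q₁'' q₂''
  rw [mul_nonneg_iff_of_pos_left hc] at q₁'' q₂''
  have : l₁ * s.re ≤ l₁ * (l₂ * (pairing N T₂).re) := by gcongr; linarith
  nlinarith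

end Entropy

/-! ### The converse bound -/

section Converse

variable {A B : Type*}

/-- States span all operators: a multiple of the identity makes a Hermitian operator positive, and X
splits into Hermitian and anti-Hermitian parts. -/
lemma eq_of_eqOn_isState {V : Type*} [AddCommGroup V] [Module ℂ V] [Fintype B]
    {f g : Matrix B B ℂ →ₗ[ℂ] V} (h : ∀ σ, IsState σ → f σ = g σ) : f = g := by
  classical
  have hpos : ∀ X : Matrix B B ℂ, X.PosSemidef → f X = g X := by
    intro X hX
    by_cases h0 : X.trace = 0
    · simp [hX.trace_eq_zero_iff.1 h0]
    · have hs := h (X.trace⁻¹ • X) ⟨hX.smul (by simpa using hX.trace_nonneg), by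
        rw [Matrix.trace_smul, smul_eq_mul, inv_mul_cancel₀ h0]⟩
      rw [map_smul, map_smul] at hs
      exact smul_right_injective _ (inv_ne_zero h0) hs
  have hherm : ∀ X : Matrix B B ℂ, X.IsHermitian → f X = g X := by
    intro X hX
    obtain ⟨c, hc⟩ := hX.exists_posSemidef_add_smul_one
    have := hpos _ (hc c le_rfl)
    rwa [map_add, map_add, map_smul, map_smul, hpos 1 Matrix.PosSemidef.one,
      add_right_cancel_iff] at this
  ext1 X
  have h₁ := hherm _ (Matrix.isHermitian_add_transpose_self X)
  have h₂ := hherm (Complex.I • (X - Xᴴ)) (by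
    rw [Matrix.IsHermitian, Matrix.conjTranspose_smul, Matrix.conjTranspose_sub]
    simp [← smul_neg])
  rw [map_smul, map_smul] at h₂
  have h₂ := smul_right_injective V Complex.I_ne_zero h₂
  have hX : X = (2⁻¹ : ℂ) • ((X + Xᴴ) + (X - Xᴴ)) := by
    rw [add_add_sub_cancel, ← two_smul ℂ X, smul_smul]
    norm_num
  rw [hX, map_smul, map_smul, map_add f, map_add g, h₁, h₂]

lemma superOp_eq_sum_entryMap [Fintype A] [DecidableEq A] [Fintype B] [DecidableEq B]
    (N : SuperOp A B) : N = ∑ b, ∑ b', ∑ i, ∑ j,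
      N (Matrix.single i j 1) b b' • entryMap i j (Matrix.single b b' 1) := by
  ext1 Z
  conv_lhs => rw [superOp_eq_sum N Z]
  ext c c'
  simp only [LinearMap.sum_apply, LinearMap.smul_apply, Matrix.sum_apply, Matrix.smul_apply,
    entryMap, LinearMap.coe_mk, AddHom.coe_mk, Matrix.single_apply, smul_eq_mul, mul_ite, mul_one,
    mul_zero, ite_and]
  rw [Finset.sum_eq_single c, Finset.sum_eq_single c']
  · simp [mul_comm]
  · intro b _ hb; simp [hb]
  · simp
  · intro b _ hb; simp [hb]
  · simp

/-- The map `Z ↦ ∑ Z i j |i b⟩⟨j b'| ⊗ |b⟩⟨b'|`, up to reindexing: its components are the maps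
`entryMap i j |b⟩⟨b'|`. -/
def entryChannel {s : ℕ} (g : Fin s → A × B) [DecidableEq B] :
    SuperOp (Fin 1 × A) (Fin s × B) where
  toFun X := Matrix.of fun p q => (if (g p.1).2 = p.2 then 1 else 0) *
    X (0, (g p.1).1) (0, (g q.1).1) * (if (g q.1).2 = q.2 then 1 else 0)
  map_add' X Y := by ext p q; simp only [Matrix.of_apply, Matrix.add_apply]; ring
  map_smul' c X := by
    ext p q
    simp only [Matrix.of_apply, Matrix.smul_apply, smul_eq_mul, RingHom.id_apply]; ring

lemma isCP_entryChannel [Finite B] {s : ℕ} (g : Fin s → A × B) [DecidableEq B] :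
    IsCP (entryChannel g) := by
  have := Fintype.ofFinite B
  intro r X hX
  let v : Fin r × Fin s × B → ℂ := fun p => if (g p.2.1).2 = p.2.2 then 1 else 0
  have h := (hX.submatrix fun p : Fin r × Fin s × B =>
    (p.1, ((0 : Fin 1), (g p.2.1).1))).conjTranspose_mul_mul_same (Matrix.diagonal v)
  have heq : ampliate (Fin r) (entryChannel g) X = (Matrix.diagonal v)ᴴ *
      X.submatrix (fun p : Fin r × Fin s × B => (p.1, ((0 : Fin 1), (g p.2.1).1)))
        (fun p : Fin r × Fin s × B => (p.1, ((0 : Fin 1), (g p.2.1).1))) * Matrix.diagonal v := by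
    ext p q
    rw [Matrix.mul_diagonal, Matrix.diagonal_conjTranspose, Matrix.diagonal_mul, ampliate_apply]
    simp [entryChannel, v]
  exact heq ▸ h

lemma component_entryChannel {s : ℕ} (g : Fin s → A × B) [DecidableEq B] (p q : Fin s) :
    component (entryChannel g) 0 0 p q =
      entryMap (g p).1 (g q).1 (Matrix.single (g p).2 (g q).2 1) := by
  ext1 Z
  ext b b'
  by_cases h₁ : (g p).2 = b <;> by_cases h₂ : (g q).2 = b' <;>
    simp [component, entryChannel, entryMap, h₁, h₂]

variable {M M' : Type*}

/-- The operator on `B ⊗ A` whose pairing with `N` is the matrix element `⟨i|Θ{N}[ρ]|i⟩`. -/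
def slotOperator [DecidableEq B] (Θ : Supermap A B M M') (ρ : Matrix M M ℂ) (i : M') :
    Matrix (B × A) (B × A) ℂ :=
  Matrix.of fun p q => Θ (entryMap p.2 q.2 (Matrix.single p.1 q.1 1)) ρ i i

lemma pairing_eq_sum [Fintype A] [DecidableEq A] [Fintype B] (N : SuperOp A B)
    (T : Matrix (B × A) (B × A) ℂ) :
    pairing N T = ∑ b, ∑ b', ∑ i, ∑ j, T (b, i) (b', j) * N (Matrix.single i j 1) b b' := by
  simp only [pairing_apply, ampliate_apply]
  refine Finset.sum_congr rfl fun b _ => Finset.sum_congr rfl fun b' _ => ?_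
  rw [superOp_eq_sum]
  simp [Matrix.sum_apply]

/-- Both sides are linear in `N`, and the slot operator records the values of `Θ` on the elementary
maps into which `N` expands. -/
lemma pairing_slotOperator [Fintype A] [Fintype B] [DecidableEq B] (Θ : Supermap A B M M')
    (ρ : Matrix M M ℂ) (i : M') (N : SuperOp A B) :
    pairing N (slotOperator Θ ρ i) = Θ N ρ i i := by
  classical
  conv_rhs => rw [superOp_eq_sum_entryMap N]
  rw [pairing_eq_sum]
  simp only [map_sum, map_smul, LinearMap.sum_apply, LinearMap.smul_apply, Matrix.sum_apply,
    Matrix.smul_apply, smul_eq_mul, slotOperator, Matrix.of_apply]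
  simp only [mul_comm]

/-- All entries of the slot operator occur in the image of one completely positive map,
`entryChannel`, under the extended supermap; this is where preservation of complete positivity on
part of a bipartite map is needed. -/
lemma slotOperator_comp_posSemidef [Fintype A] [Fintype B] [DecidableEq B] [Fintype M]
    [Fintype M'] {C : Type*} {Ξ : Supermap A B M M'} (hΞ : IsSuperchannel Ξ)
    {D : SuperOp M' C} (hD : IsCP D) {Θ : Supermap A B M C} (hΘ : ∀ N, Θ N = D ∘ₗ Ξ N)
    {ρ : Matrix M M ℂ} (hρ : ρ.PosSemidef) (i : C) : (slotOperator Θ ρ i).PosSemidef := by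
  obtain ⟨s, ⟨e⟩⟩ := Finite.exists_equiv_fin (A × B)
  have h := (hD.ampliate_posSemidef (R := Fin s)
    ((hΞ.cp 1 s _ (isCP_entryChannel e.symm)).posSemidef
      (hρ.submatrix (Prod.snd : Fin 1 × M → M)))).submatrix
    fun p : B × A => (e (p.2, p.1), i)
  convert h using 1
  ext p q
  simp only [slotOperator, Matrix.of_apply, hΘ, LinearMap.comp_apply, Matrix.submatrix_apply,
    ampliate_apply]
  refine congrArg (fun Y => D Y i i) ?_
  ext k l
  simp [Supermap.extend, component_entryChannel]

lemma traceMap_eq_sum [Fintype A] (Y : Matrix B B ℂ) :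
    traceMap Y = ∑ a : A, entryMap a a Y := by
  ext1 Z
  simp [entryMap, Matrix.trace, Finset.sum_smul]

/-- Discarding the exposed output A while feeding σ into B closes the slot with the replacement map
Z ↦ tr(Z) σ. -/
lemma traceFst_bipartite [Fintype A] [Fintype B] [DecidableEq B] [Fintype M] [DecidableEq M]
    (Θ : Supermap A B M M') (ρ : Matrix M M ℂ) (σ : Matrix B B ℂ) :
    traceFst (Θ.bipartite (ρ ⊗ₖ σ)) = Θ (traceMap σ) ρ := by
  have hσ : ∀ a, entryMap (A := A) a a σ =
      ∑ b, ∑ b', σ b b' • entryMap a a (Matrix.single b b' 1) := fun a => by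
    ext1 Z
    conv_lhs => rw [Matrix.matrix_eq_sum_single σ]
    simp [entryMap, Finset.smul_sum, Matrix.smul_single, mul_comm]
  ext k l
  rw [superOp_eq_sum (Θ (traceMap σ)) ρ, traceMap_eq_sum]
  simp only [hσ, traceFst, Supermap.bipartite, Matrix.of_apply, map_sum, map_smul,
    LinearMap.sum_apply, LinearMap.smul_apply, Matrix.sum_apply, Matrix.smul_apply,
    Matrix.kroneckerMap_apply, LinearMap.coe_mk, AddHom.coe_mk, smul_eq_mul, Finset.mul_sum,
    mul_assoc]
  refine Finset.sum_comm.trans (Finset.sum_congr rfl fun m _ => ?_)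
  exact Finset.sum_comm

lemma isState_single [Fintype M] [DecidableEq M] (m : M) :
    IsState (Matrix.single m m (1 : ℂ)) := by
  refine ⟨?_, Matrix.trace_single_eq_same m 1⟩
  rw [← Matrix.diagonal_single]
  exact Matrix.PosSemidef.diagonal (by simp)

/-- The marginal on B lists the values of `Θ` on replacement maps, on which nonsignalling removes
the dependence on the message. The hypothesis covers states σ only, whereas matrix units are needed,
hence the detour through the linear map `L`. -/
lemma traceSnd_slotOperator_eq [Fintype A] [Fintype B] [DecidableEq B] [Fintype M]
    [DecidableEq M] [Fintype M'] {C : Type*} {Ξ : Supermap A B M M'} (hΞ : IsNA Ξ)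
    {D : SuperOp M' C} {Θ : Supermap A B M C} (hΘ : ∀ N, Θ N = D ∘ₗ Ξ N) (m m' : M) (i : C) :
    traceSnd (slotOperator Θ (Matrix.single m m 1) i) =
      traceSnd (slotOperator Θ (Matrix.single m' m' 1) i) := by
  let L : M → Matrix B B ℂ →ₗ[ℂ] Matrix M' M' ℂ := fun m =>
    { toFun := fun σ => Ξ (traceMap σ) (Matrix.single m m 1)
      map_add' := fun σ τ => by
        rw [show traceMap (A := A) (σ + τ) = traceMap σ + traceMap τ from
          LinearMap.ext fun Z => smul_add _ _ _, map_add]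
        rfl
      map_smul' := fun c σ => by
        rw [show traceMap (A := A) (c • σ) = c • traceMap σ from
          LinearMap.ext fun Z => smul_comm _ _ _, map_smul]
        rfl }
  have hLL : L m = L m' := eq_of_eqOn_isState fun σ hσ => by
    have h := hΞ.2 _ _ σ (isState_single m) (isState_single m') hσ
    rwa [traceFst_bipartite, traceFst_bipartite] at h
  have key : ∀ m b b', traceSnd (slotOperator Θ (Matrix.single m m 1) i) b b' =
      D (L m (Matrix.single b b' 1)) i i := fun m b b' => by
    simp [traceSnd, slotOperator, hΘ, L, map_sum, Matrix.sum_apply, traceMap_eq_sum]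
  ext b b'
  rw [key, key, hLL]

/-- A postselected nonsignalling-assisted protocol of conditional error `ε` has message dimension
at most `1 + ε / (1 - ε) * 2 ^ I(N)`. -/
lemma dim_le_of_mem_pNA [Fintype A] [Fintype B] [DecidableEq B] {N : SuperOp A B}
    (hN : IsChannel N) {ε : ℝ} (hε1 : ε < 1) {d : ℕ} (hd : 1 ≤ d)
    {Θ : Supermap A B (Fin d) (Fin d)} (hΘ : Θ ∈ pNA A B d) (herr : errC (Θ N) ≤ ε) {l : ℝ}
    (hl : channelProjectiveInfo N < log2 (ENNReal.ofReal l)) :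
    ((d : ℝ) - 1) * (1 - ε) ≤ ε * l := by
  obtain ⟨Ξ, D, hΞ, hD, hΘ⟩ := hΘ
  have hl0 : 0 < l := by
    by_contra h
    rw [ENNReal.ofReal_of_nonpos (not_lt.1 h)] at hl
    refine hl.not_ge ?_
    simp [log2, EReal.bot_div_of_pos_ne_top, Real.log_pos one_lt_two]
  let E : Fin d → Matrix (Fin d) (Fin d) ℂ := fun m => Matrix.single m m 1
  have hE : ∀ m, (E m).PosSemidef := fun m => (isState_single m).1
  let u : Fin d → Fin d → ℝ := fun m k => (Θ N (E m) k k).re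
  have hT : ∀ m k, (slotOperator Θ (E m) k).PosSemidef := fun m k =>
    slotOperator_comp_posSemidef hΞ.1 hD.1 hΘ (hE m) k
  have hu : ∀ m k, u m k = (pairing N (slotOperator Θ (E m) k)).re := fun m k => by
    rw [pairing_slotOperator]
  have hu0 : ∀ m k, 0 ≤ u m k := fun m k => by
    rw [hu]; exact (Complex.nonneg_iff.1 (pairing_nonneg hN.1 (hT m k))).1
  have hul : ∀ m k, u k k ≤ l * u m k := fun m k => by
    rw [hu, hu]
    exact pairing_le hN hl (hT k k) (hT m k) (traceSnd_slotOperator_eq hΞ hΘ k m k)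
  have htr : ∀ m, (Θ N (E m)).trace.re = ∑ k, u m k := fun m => by
    simp [Matrix.trace, u]
  have hs : ∀ m, (E m * Θ N (E m)).trace.re = u m m := fun m => by
    simp [E, Matrix.trace_single_mul, u]
  have hm : ∀ m, (1 - ε) * ∑ k, u m k ≤ u m m ∧ 0 < u m m := by
    intro m
    have h₁ : 1 - ε ≤ u m m / ∑ k, u m k := by
      have := ciInf_le (f := fun m : Fin d => (E m * Θ N (E m)).trace.re / (Θ N (E m)).trace.re)
        (Set.finite_range _).bddBelow m
      simp only [htr, hs] at this
      simp only [errC] at herr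
      change 1 - (⨅ m, (E m * Θ N (E m)).trace.re / (Θ N (E m)).trace.re) ≤ ε at herr
      simp only [htr, hs] at herr
      linarith
    -- A vanishing conclusive probability would make the quotient 0 / 0 = 0, below 1 - ε.
    have h₂ : 0 < ∑ k, u m k := by
      refine (Finset.sum_nonneg fun k _ => hu0 m k).lt_of_ne fun h => ?_
      rw [← h, div_zero] at h₁
      linarith
    have h₃ := (le_div_iff₀ h₂).1 h₁
    exact ⟨h₃, lt_of_lt_of_le (mul_pos (by linarith) h₂) h₃⟩
  have hsum : (1 - ε) * ∑ m, ∑ k, u m k ≤ ∑ m, u m m := by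
    rw [Finset.mul_sum]
    exact Finset.sum_le_sum fun m _ => (hm m).1
  set S := ∑ m, u m m with hS
  have hSpos : 0 < S := Finset.sum_pos (fun m _ => (hm m).2) ⟨⟨0, hd⟩, Finset.mem_univ _⟩
  -- For each m, `hul` is summed over the wrong outcomes k ≠ m, then over m; every correct weight `u
  -- k k` is counted d - 1 times.
  have hlow : (d : ℝ) * S - S ≤ l * (∑ m, ∑ k, u m k - S) := by
    have h : ∀ m, S - u m m ≤ l * (∑ k, u m k - u m m) := fun m => by
      rw [hS, ← Finset.sum_erase_eq_sub (Finset.mem_univ m),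
        ← Finset.sum_erase_eq_sub (Finset.mem_univ m), Finset.mul_sum]
      exact Finset.sum_le_sum fun k _ => hul m k
    have := Finset.sum_le_sum fun m (_ : m ∈ Finset.univ) => h m
    rw [← Finset.mul_sum, Finset.sum_sub_distrib, Finset.sum_sub_distrib] at this
    simpa using this
  have h₁ : (1 - ε) * ((d : ℝ) * S - S) ≤ (1 - ε) * (l * (∑ m, ∑ k, u m k - S)) := by
    gcongr
  have h₂ : l * ((1 - ε) * ∑ m, ∑ k, u m k) ≤ l * S := by gcongr
  refine le_of_mul_le_mul_right ?_ hSpos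
  nlinarith

end Converse

/-! ### Optimal pairs of encoders -/

section Encoders

variable {A B : Type*}

lemma exists_lt_pairing [Fintype A] [Fintype B] {N : SuperOp A B} (hN : IsChannel N) {l : ℝ}
    (hl : log2 (ENNReal.ofReal l) < channelProjectiveInfo N) :
    ∃ T₁ T₂ : Matrix (B × A) (B × A) ℂ, T₁.PosSemidef ∧ T₂.PosSemidef ∧
      traceSnd T₁ = traceSnd T₂ ∧ l * (pairing N T₂).re < (pairing N T₁).re := by
  by_contra! h
  obtain ⟨Y, h₁, h₂⟩ := exists_traceMap_between hN.1 l h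
  exact hl.not_ge (channelProjectiveInfo_le hN h₁ h₂)

open scoped MatrixOrder in
lemma _root_.Matrix.PosDef.exists_eq_mul_conjTranspose {n : Type*} [Fintype n] [DecidableEq n]
    {K : Matrix n n ℂ} (hK : K.PosDef) : ∃ L : Matrix n n ℂ, IsUnit L.det ∧ K = L * Lᴴ := by
  obtain ⟨L, hL, h⟩ := CStarAlgebra.isStrictlyPositive_iff_eq_mul_star_self.mp
    hK.isStrictlyPositive
  exact ⟨L, (Matrix.isUnit_iff_isUnit_det L).1 hL, h⟩

/-- `(L ⊗ 1) X (L ⊗ 1)†`. -/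
def conjFst [Fintype A] [Fintype B] [DecidableEq A] (L : Matrix B B ℂ)
    (X : Matrix (B × A) (B × A) ℂ) : Matrix (B × A) (B × A) ℂ :=
  (L ⊗ₖ (1 : Matrix A A ℂ)) * X * (L ⊗ₖ (1 : Matrix A A ℂ))ᴴ

lemma conjFst_apply [Fintype A] [Fintype B] [DecidableEq A] (L : Matrix B B ℂ)
    (X : Matrix (B × A) (B × A) ℂ) (p q : B × A) :
    conjFst L X p q = ∑ c, ∑ c', L p.1 c * star (L q.1 c') * X (c, p.2) (c', q.2) := by
  simp only [conjFst, Matrix.mul_apply, Fintype.sum_prod_type, Matrix.kroneckerMap_apply,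
    Matrix.one_apply, Matrix.conjTranspose_apply, apply_ite star, star_zero,
    mul_ite, mul_one, mul_zero, ite_mul, zero_mul, Finset.sum_ite_eq, Finset.mem_univ, if_true,
    Finset.sum_mul]
  rw [Finset.sum_comm]
  refine Finset.sum_congr rfl fun c _ => Finset.sum_congr rfl fun c' _ => ?_
  ring

lemma traceSnd_conjFst [Fintype A] [Fintype B] [DecidableEq A] (L : Matrix B B ℂ)
    (X : Matrix (B × A) (B × A) ℂ) : traceSnd (conjFst L X) = L * traceSnd X * Lᴴ := by
  ext b b'
  simp only [traceSnd, Matrix.of_apply, conjFst_apply, Matrix.mul_apply, Finset.sum_mul,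
    Finset.mul_sum, Matrix.conjTranspose_apply]
  rw [Finset.sum_comm]
  conv_rhs => rw [Finset.sum_comm]
  refine Finset.sum_congr rfl fun c _ => ?_
  rw [Finset.sum_comm]
  refine Finset.sum_congr rfl fun c' _ => Finset.sum_congr rfl fun a _ => ?_
  ring

/-- `⟨w̄| (id ⊗ N)[C] |w̄⟩`. -/
def testProb [Fintype B] (N : SuperOp A B) (w : B × B → ℂ) (C : Matrix (B × A) (B × A) ℂ) : ℂ :=
  ∑ p, ∑ q, w p * star (w q) * ampliate B N C p q

/-- A filter on the reference side of the input can be moved into the test: Ω is replaced by the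
vector with coefficients from `L`. -/
lemma pairing_conjFst [Fintype A] [Fintype B] [DecidableEq A] (N : SuperOp A B)
    (L : Matrix B B ℂ) (C : Matrix (B × A) (B × A) ℂ) :
    pairing N (conjFst L C) = testProb N (fun p => L p.2 p.1) C := by
  have h : ∀ b b', (conjFst L C).submatrix (Prod.mk b) (Prod.mk b') =
      ∑ c, ∑ c', (L b c * star (L b' c')) • C.submatrix (Prod.mk c) (Prod.mk c') := by
    intro b b'
    ext a a'
    simp [conjFst_apply, Matrix.sum_apply]
  simp only [pairing_apply, testProb, ampliate_apply, h, map_sum, map_smul, Matrix.sum_apply,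
    Matrix.smul_apply, smul_eq_mul, Fintype.sum_prod_type]
  rw [Finset.sum_congr rfl fun b _ => Finset.sum_comm, Finset.sum_comm]
  refine Finset.sum_congr rfl fun c _ => Finset.sum_congr rfl fun b _ => ?_
  exact Finset.sum_comm

lemma _root_.Matrix.PosSemidef.conjFst [Fintype A] [Fintype B] [DecidableEq A] (L : Matrix B B ℂ)
    {X : Matrix (B × A) (B × A) ℂ} (hX : X.PosSemidef) : (conjFst L X).PosSemidef :=
  hX.mul_mul_conjTranspose_same _

/-- Below `2 ^ I(N)` there are two channels `B → A`, given by their Choi matrices `C₁`, `C₂`, and a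
test distinguishing their outputs with the given likelihood ratio. -/
lemma exists_encoders [Fintype A] [Nonempty A] [Fintype B] [DecidableEq B] {N : SuperOp A B}
    (hN : IsChannel N) {l : ℝ} (hl0 : 0 ≤ l)
    (hl : log2 (ENNReal.ofReal l) < channelProjectiveInfo N) :
    ∃ (C₁ C₂ : Matrix (B × A) (B × A) ℂ) (w : B × B → ℂ), C₁.PosSemidef ∧ C₂.PosSemidef ∧
      traceSnd C₁ = 1 ∧ traceSnd C₂ = 1 ∧ l * (testProb N w C₂).re < (testProb N w C₁).re := by
  classical
  obtain ⟨T₁, T₂, h₁, h₂, h, hlt⟩ := exists_lt_pairing hN hl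
  set c := (pairing N 1).re with hc
  have hc0 : 0 ≤ c := (Complex.nonneg_iff.1 (pairing_nonneg hN.1 Matrix.PosSemidef.one)).1
  let η := (pairing N T₁).re - l * (pairing N T₂).re
  have hη : 0 < η := sub_pos.2 hlt
  -- Adding δ · 1 to both operators makes the common marginal invertible. It raises both pairings by
  -- δ c, so the strict gap η survives as soon as δ l c < η; the `+ 1` keeps the denominator
  -- positive.
  let δ : ℝ := η / (2 * (l * c + 1))
  have hlc : 0 ≤ l * c := mul_nonneg hl0 hc0
  have hδ : 0 < δ := by positivity
  have hδη : δ * (l * c) < η := by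
    have : δ * (2 * (l * c + 1)) = η := div_mul_cancel₀ _ (by positivity)
    nlinarith
  let S : Matrix (B × A) (B × A) ℂ → Matrix (B × A) (B × A) ℂ := fun T => T + (δ : ℂ) • 1
  have hδC : (0 : ℂ) ≤ δ := by exact_mod_cast hδ.le
  have hS : ∀ T, T.PosSemidef → (S T).PosSemidef := fun T hT =>
    hT.add (Matrix.PosSemidef.one.smul hδC)
  have hSp : ∀ T, (pairing N (S T)).re = (pairing N T).re + δ * c := fun T => by
    simp [S, hc]
  have hone : traceSnd (1 : Matrix (B × A) (B × A) ℂ) = (Fintype.card A : ℂ) • 1 := by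
    ext b b'
    by_cases hb : b = b'
    · subst hb; simp [traceSnd]
    · simp [traceSnd, hb, Matrix.one_apply]
  have hSm : ∀ T, traceSnd (S T) = traceSnd T + ((δ : ℂ) * Fintype.card A) • 1 := fun T => by
    rw [← traceSndLinear_apply, map_add, map_smul, traceSndLinear_apply, traceSndLinear_apply,
      hone, smul_smul]
  have hK : (traceSnd (S T₁)).PosDef := by
    rw [hSm]
    refine Matrix.PosDef.posSemidef_add h₁.traceSnd (Matrix.PosDef.one.smul ?_)
    have : 0 < δ * Fintype.card A := mul_pos hδ (by exact_mod_cast Fintype.card_pos)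
    exact_mod_cast this
  -- Conjugation by `L⁻¹` turns the common marginal L L† into the identity, which is trace
  -- preservation for Choi matrices.
  obtain ⟨L, hL, hKL⟩ := hK.exists_eq_mul_conjTranspose
  have hcancel : ∀ T, conjFst L (conjFst L⁻¹ T) = T := fun T => by
    have e : (L ⊗ₖ (1 : Matrix A A ℂ)) * (L⁻¹ ⊗ₖ (1 : Matrix A A ℂ)) = 1 := by
      rw [← Matrix.mul_kronecker_mul, Matrix.mul_nonsing_inv _ hL, mul_one, Matrix.one_kronecker_one]
    calc conjFst L (conjFst L⁻¹ T) = ((L ⊗ₖ (1 : Matrix A A ℂ)) * (L⁻¹ ⊗ₖ (1 : Matrix A A ℂ))) * T *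
          ((L ⊗ₖ (1 : Matrix A A ℂ)) * (L⁻¹ ⊗ₖ (1 : Matrix A A ℂ)))ᴴ := by
          simp only [conjFst, Matrix.conjTranspose_mul, Matrix.mul_assoc]
      _ = T := by rw [e]; simp
  have hinv : ∀ T, traceSnd (S T) = L * Lᴴ → traceSnd (conjFst L⁻¹ (S T)) = 1 := fun T hT => by
    rw [traceSnd_conjFst, hT, ← Matrix.mul_assoc, Matrix.nonsing_inv_mul _ hL, Matrix.one_mul,
      ← Matrix.conjTranspose_mul, Matrix.nonsing_inv_mul _ hL, Matrix.conjTranspose_one]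
  refine ⟨conjFst L⁻¹ (S T₁), conjFst L⁻¹ (S T₂), fun p => L p.2 p.1, (hS _ h₁).conjFst _,
    (hS _ h₂).conjFst _, hinv _ hKL, hinv _ ?_, ?_⟩
  · rw [← hKL, hSm, hSm, h]
  · rw [← pairing_conjFst, ← pairing_conjFst, hcancel, hcancel, hSp, hSp]
    have : 0 ≤ δ * c := by positivity
    simp only [η] at hδη
    nlinarith

end Encoders

/-! ### Achievability -/

section Achievability

variable {A B A' B' M M' C R : Type*}

lemma ampliate_add_left (N N' : SuperOp A B) (X : Matrix (R × A) (R × A) ℂ) :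
    ampliate R (N + N') X = ampliate R N X + ampliate R N' X := by
  ext p q; simp [ampliate_apply]

lemma ampliate_smul_left (c : ℂ) (N : SuperOp A B) (X : Matrix (R × A) (R × A) ℂ) :
    ampliate R (c • N) X = c • ampliate R N X := by
  ext p q; simp [ampliate_apply]

/-- `ρ ↦ ρ ⊗ γ`, with the tensor factors listed in the order `B', M, A'`. -/
def shareMap (M : Type*) (γ : Matrix (A' × B') (A' × B') ℂ) : SuperOp M (B' × M × A') :=
  submatrixMap (fun x : B' × M × A' => (x.2.1, x.2.2, x.1)) ∘ₗ kroneckerRight M γ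

/-- The supermap `N ↦ D ∘ (id ⊗ N) ∘ (id ⊗ E) ∘ (· ⊗ γ)`. -/
def assisted (γ : Matrix (A' × B') (A' × B') ℂ) (E : SuperOp (M × A') A)
    (D : SuperOp (B' × B) M') : Supermap A B M M' where
  toFun N := D ∘ₗ ampliate B' N ∘ₗ ampliate B' E ∘ₗ shareMap M γ
  map_add' N N' := by
    ext1 ρ
    simp only [LinearMap.comp_apply, LinearMap.add_apply, ampliate_add_left, map_add]
  map_smul' c N := by
    ext1 ρ
    simp only [LinearMap.comp_apply, LinearMap.smul_apply, ampliate_smul_left, map_smul,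
      RingHom.id_apply]

lemma assisted_apply (γ : Matrix (A' × B') (A' × B') ℂ) (E : SuperOp (M × A') A)
    (D : SuperOp (B' × B) M') (N : SuperOp A B) (ρ : Matrix M M ℂ) :
    assisted γ E D N ρ = D (ampliate B' N (ampliate B' E (withShared ρ γ))) := rfl

/-- The map with a given Choi matrix. -/
def ofChoi [Fintype B] (C : Matrix (B × A) (B × A) ℂ) : SuperOp B A where
  toFun X := Matrix.of fun a a' => ∑ b, ∑ b', X b b' * C (b, a) (b', a')
  map_add' X Y := by ext a a'; simp [add_mul, Finset.sum_add_distrib]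
  map_smul' c X := by ext a a'; simp [Finset.mul_sum, mul_assoc]

lemma isCP_ofChoi [Finite A] [Fintype B] {C : Matrix (B × A) (B × A) ℂ} (hC : C.PosSemidef) :
    IsCP (ofChoi C) := by
  classical
  refine isCP_of_choi ?_
  convert hC using 1
  ext p q
  simp [choi, ofChoi, Matrix.single_apply, ite_and]

lemma trace_ofChoi [Fintype A] [Fintype B] [DecidableEq B] {C : Matrix (B × A) (B × A) ℂ}
    (hC : traceSnd C = 1) (X : Matrix B B ℂ) : (ofChoi C X).trace = X.trace := by
  have h : ∀ b b', ∑ a, C (b, a) (b', a) = (1 : Matrix B B ℂ) b b' := fun b b' => by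
    rw [← hC]; rfl
  simp only [Matrix.trace, ofChoi, LinearMap.coe_mk, AddHom.coe_mk, Matrix.diag_apply,
    Matrix.of_apply]
  rw [Finset.sum_comm]
  refine Finset.sum_congr rfl fun b _ => ?_
  rw [Finset.sum_comm]
  simp only [← Finset.mul_sum, h, Matrix.one_apply]
  simp

/-- Measure `m` and `g` in the register `M ⊗ G`, and apply the map with Choi matrix `C m g` to the
remaining part; the registers `G ⊗ B` are encoded in `A'`. -/
def controlledEncoder {G : Type*} [Fintype M] [Fintype G] [Fintype B] (e : G × B → A')
    (C : M → G → Matrix (B × A) (B × A) ℂ) : SuperOp (M × A') A :=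
  ∑ m, ∑ g, ofChoi (C m g) ∘ₗ submatrixMap fun b => (m, e (g, b))

lemma isChannel_controlledEncoder {G : Type*} [Fintype M] [Fintype G] [Fintype A] [Fintype B]
    [Fintype A'] [DecidableEq B] (e : G × B ≃ A') {C : M → G → Matrix (B × A) (B × A) ℂ}
    (hC : ∀ m g, (C m g).PosSemidef) (hC' : ∀ m g, traceSnd (C m g) = 1) :
    IsChannel (controlledEncoder e C) := by
  refine ⟨IsCP.sum fun m _ => IsCP.sum fun g _ => (isCP_ofChoi (hC m g)).comp
    (isCP_submatrixMap _), fun X => ?_⟩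
  simp only [controlledEncoder, LinearMap.sum_apply, LinearMap.comp_apply, Matrix.trace_sum,
    trace_ofChoi (hC' _ _), submatrixMap_apply]
  simp only [Matrix.trace, Matrix.diag_apply, Matrix.submatrix_apply, Fintype.sum_prod_type]
  refine Finset.sum_congr rfl fun m _ => ?_
  rw [← Equiv.sum_comp e, Fintype.sum_prod_type]

/-- `Y ↦ ⟨w̄|Y|w̄⟩ |g⟩⟨g|`. -/
def testMap {G : Type*} [Fintype A] [DecidableEq G] (w : A → ℂ) (g : G) : SuperOp A G where
  toFun Y := (∑ p, ∑ q, w p * star (w q) * Y p q) • Matrix.single g g 1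
  map_add' X Y := by
    rw [← add_smul]; simp only [Matrix.add_apply, mul_add, Finset.sum_add_distrib]
  map_smul' c X := by
    simp only [Matrix.smul_apply, smul_eq_mul, RingHom.id_apply, smul_smul, Finset.mul_sum]
    simp only [mul_left_comm c]

lemma isCP_testMap {G : Type*} [Fintype A] [DecidableEq G] [Finite G] (w : A → ℂ) (g : G) :
    IsCP (testMap w g) := by
  classical
  refine isCP_of_choi ?_
  convert Matrix.posSemidef_vecMulVec_self_star
    (fun p : A × G => if p.2 = g then w p.1 else 0) using 1
  ext p q
  have h : ∑ a, ∑ a', w a * star (w a') * Matrix.single p.1 q.1 (1 : ℂ) a a' =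
      w p.1 * star (w q.1) := by
    simp [Matrix.single_apply, ite_and]
  simp only [choi, testMap, LinearMap.coe_mk, AddHom.coe_mk, Matrix.of_apply, h,
    Matrix.smul_apply, Matrix.vecMulVec_apply, Pi.star_apply]
  by_cases h₁ : p.2 = g <;> by_cases h₂ : q.2 = g <;>
    simp [h₁, h₂, eq_comm (a := g)]

/-- The operator |w⟩⟨w| is dominated by a multiple c of the identity; pair the difference with Y
entrywise. -/
lemma exists_test_le_trace [Fintype A] (w : A → ℂ) : ∃ c : ℝ, 0 < c ∧
    ∀ Y : Matrix A A ℂ, Y.PosSemidef →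
      (∑ p, ∑ q, w p * star (w q) * Y p q).re ≤ c * Y.trace.re := by
  classical
  obtain ⟨c, hc⟩ :=
    (Matrix.posSemidef_vecMulVec_self_star w).isHermitian.neg.exists_posSemidef_add_smul_one
  refine ⟨max c 1, by positivity, fun Y hY => ?_⟩
  have h := (((hc _ (le_max_left c 1)).kronecker hY).submatrix fun p => (p, p)).sum_sum_nonneg
  have h' := (Complex.nonneg_iff.1 h).1
  have e : ∑ i, ∑ j, ((-Matrix.vecMulVec w (star w) + ((max c 1 : ℝ) : ℂ) • 1) ⊗ₖ Y).submatrix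
      (fun p => (p, p)) (fun p => (p, p)) i j =
      ((max c 1 : ℝ) : ℂ) * Y.trace - ∑ p, ∑ q, w p * star (w q) * Y p q := by
    simp only [Matrix.submatrix_apply, Matrix.kroneckerMap_apply, Matrix.add_apply,
      Matrix.neg_apply, Matrix.vecMulVec_apply, Matrix.smul_apply, Matrix.one_apply, Pi.star_apply,
      smul_eq_mul, add_mul, Finset.sum_add_distrib, neg_mul, Finset.sum_neg_distrib]
    simp [Matrix.trace, Finset.mul_sum]
    ring
  rw [e] at h'
  simpa using h'

/-- Measure `g` in the register `G`, test the remaining part against `w`, and return `g`; the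
registers `G ⊗ B` are encoded in `B'`. -/
def testDecoder {G : Type*} [Fintype G] [DecidableEq G] [Fintype B] (e : G × B → B')
    (w : B × B → ℂ) (κ : ℝ) : SuperOp (B' × B) G :=
  (κ : ℂ) • ∑ g, testMap w g ∘ₗ submatrixMap fun p : B × B => (e (g, p.1), p.2)

/-- The test vector is not normalized, so the decoder is scaled down to be trace nonincreasing. The
factor is harmless, since it cancels in conditional probabilities. -/
lemma exists_isSubchannel_testDecoder {G : Type*} [Fintype G] [DecidableEq G] [Fintype B]
    [Fintype B'] (e : G × B ≃ B') (w : B × B → ℂ) :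
    ∃ κ : ℝ, 0 < κ ∧ IsSubchannel (testDecoder e w κ) := by
  obtain ⟨c, hc, h⟩ := exists_test_le_trace w
  refine ⟨c⁻¹, inv_pos.2 hc, (IsCP.sum fun g _ => (isCP_testMap w g).comp
    (isCP_submatrixMap _)).smul (by exact_mod_cast (inv_pos.2 hc).le), fun X hX => ?_⟩
  have h₁ : X.trace = ∑ g, (X.submatrix (fun p : B × B => (e (g, p.1), p.2))
      (fun p : B × B => (e (g, p.1), p.2))).trace := by
    simp only [Matrix.trace, Matrix.diag_apply, Matrix.submatrix_apply, Fintype.sum_prod_type]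
    rw [← Equiv.sum_comp e, Fintype.sum_prod_type]
  have h₂ : (testDecoder e w c⁻¹ X).trace.re = c⁻¹ * ∑ g, (∑ p, ∑ q, w p * star (w q) *
      X.submatrix (fun p : B × B => (e (g, p.1), p.2))
        (fun p : B × B => (e (g, p.1), p.2)) p q).re := by
    simp only [testDecoder, testMap, LinearMap.smul_apply, LinearMap.sum_apply,
      LinearMap.comp_apply, LinearMap.coe_mk, AddHom.coe_mk, Matrix.trace_smul, Matrix.trace_sum,
      Matrix.trace_single_eq_same, smul_eq_mul, mul_one, Complex.re_ofReal_mul, Complex.re_sum,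
      submatrixMap_apply]
  rw [h₂, inv_mul_le_iff₀ hc, h₁, Complex.re_sum, Finset.mul_sum]
  exact Finset.sum_le_sum fun g _ => h _ (hX.submatrix _)

/-- The maximally entangled state of dimension `n`. -/
def maxEntangled (n : ℕ) : Matrix (Fin n × Fin n) (Fin n × Fin n) ℂ :=
  (n : ℂ)⁻¹ • Matrix.vecMulVec (fun p => if p.1 = p.2 then 1 else 0)
    (star fun p => if p.1 = p.2 then 1 else 0)

lemma maxEntangled_apply {n : ℕ} (p q : Fin n × Fin n) :
    maxEntangled n p q = if p.1 = p.2 ∧ q.1 = q.2 then (n : ℂ)⁻¹ else 0 := by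
  by_cases h₁ : p.1 = p.2 <;> by_cases h₂ : q.1 = q.2 <;>
    simp [maxEntangled, Matrix.vecMulVec_apply, h₁, h₂]

lemma isState_maxEntangled {n : ℕ} (hn : n ≠ 0) : IsState (maxEntangled n) := by
  refine ⟨(Matrix.posSemidef_vecMulVec_self_star _).smul (by simp), ?_⟩
  simp [Matrix.trace, maxEntangled_apply, Fintype.sum_prod_type, hn]

/-- The maximally entangled state makes the two measured values of the register `G` agree.
Conditioned on the value k, the encoder turns the rest into a multiple of `C m k`, on which Bob's
test is evaluated after `N`. -/
lemma assisted_controlledEncoder_apply {d n : ℕ} [Fintype B] (e : Fin d × B ≃ Fin n)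
    (C : Fin d → Fin d → Matrix (B × A) (B × A) ℂ) (w : B × B → ℂ) (κ : ℝ) (N : SuperOp A B)
    (m k : Fin d) :
    assisted (maxEntangled n) (controlledEncoder e C) (testDecoder e w κ) N
      (Matrix.single m m 1) k k = κ * (n : ℂ)⁻¹ * testProb N w (C m k) := by
  classical
  have hE : ∀ b b', (ampliate (Fin n) (controlledEncoder e C)
      (withShared (Matrix.single m m 1) (maxEntangled n))).submatrix (Prod.mk (e (k, b)))
        (Prod.mk (e (k, b'))) = (n : ℂ)⁻¹ • (C m k).submatrix (Prod.mk b) (Prod.mk b') := by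
    intro b b'
    have h : (withShared (Matrix.single m m (1 : ℂ)) (maxEntangled n)).submatrix
        (Prod.mk (e (k, b))) (Prod.mk (e (k, b'))) =
        (n : ℂ)⁻¹ • Matrix.single (m, e (k, b)) (m, e (k, b')) 1 := by
      ext ⟨m₁, x⟩ ⟨m₂, y⟩
      simp only [withShared, Matrix.submatrix_apply, Matrix.kroneckerMap_apply,
        maxEntangled_apply, Matrix.smul_apply, Matrix.single_apply, Prod.mk.injEq, smul_eq_mul]
      by_cases h₁ : m = m₁ <;> by_cases h₂ : m = m₂ <;> by_cases h₃ : x = e (k, b) <;>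
        by_cases h₄ : y = e (k, b') <;>
        simp [h₁, h₂, h₃, h₄, eq_comm (a := e (k, b)), eq_comm (a := e (k, b'))]
    ext a a'
    rw [Matrix.submatrix_apply, ampliate_apply, h, map_smul, Matrix.smul_apply, Matrix.smul_apply]
    congr 1
    simp only [controlledEncoder, LinearMap.sum_apply, LinearMap.comp_apply, Matrix.sum_apply]
    rw [Finset.sum_eq_single m, Finset.sum_eq_single k]
    · have : (submatrixMap fun c => (m, e (k, c))) (Matrix.single (m, e (k, b)) (m, e (k, b'))
          (1 : ℂ)) = Matrix.single b b' 1 := by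
        ext c c'
        simp [Matrix.single_apply]
      rw [this]
      simp [ofChoi, Matrix.single_apply, ite_and]
    · intro g _ hg
      have : (submatrixMap fun c => (m, e (g, c))) (Matrix.single (m, e (k, b)) (m, e (k, b'))
          (1 : ℂ)) = 0 := by
        ext c c'
        simp [hg.symm]
      rw [this, map_zero]; rfl
    · simp
    · intro m' _ hm
      refine Finset.sum_eq_zero fun g _ => ?_
      have : (submatrixMap fun c => (m', e (g, c))) (Matrix.single (m, e (k, b)) (m, e (k, b'))
          (1 : ℂ)) = 0 := by
        ext c c'
        simp [hm.symm]
      rw [this, map_zero]; rfl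
    · simp
  rw [assisted_apply, testDecoder]
  simp only [LinearMap.smul_apply, LinearMap.sum_apply, LinearMap.comp_apply, Matrix.smul_apply,
    Matrix.sum_apply]
  rw [Finset.sum_eq_single k]
  · simp only [testMap, LinearMap.coe_mk, AddHom.coe_mk, Matrix.smul_apply,
      Matrix.single_apply_same, smul_eq_mul, mul_one, submatrixMap_apply, Matrix.submatrix_apply,
      testProb, ampliate_apply, hE, map_smul, mul_assoc]
    congr 1
    simp only [Finset.mul_sum]
    refine Finset.sum_congr rfl fun p _ => Finset.sum_congr rfl fun q _ => ?_
    ring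
  · intro g _ hg
    simp [testMap, hg]
  · simp

/-- Every message dimension `d` with `(d - 1) (1 - ε) < ε 2 ^ I(N)` is achieved by a postselected
entanglement-assisted protocol of conditional error at most `ε`. -/
lemma exists_mem_pEA [Fintype A] [Nonempty A] [Fintype B] [Nonempty B] {N : SuperOp A B}
    (hN : IsChannel N) {ε : ℝ} (hε0 : 0 < ε) (hε1 : ε < 1) {d : ℕ} (hd : 1 ≤ d)
    (hl : log2 (ENNReal.ofReal ((d - 1) * (1 - ε) / ε)) < channelProjectiveInfo N) :
    ∃ Θ ∈ pEA A B d, errC (Θ N) ≤ ε := by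
  classical
  have hd' : (0 : ℝ) ≤ d - 1 := by
    rw [sub_nonneg]; exact_mod_cast hd
  obtain ⟨C₁, C₂, w, h₁, h₂, ht₁, ht₂, hlt⟩ := exists_encoders hN
    (div_nonneg (mul_nonneg hd' (by linarith)) hε0.le) hl
  let C : Fin d → Fin d → Matrix (B × A) (B × A) ℂ := fun m g => if m = g then C₁ else C₂
  have hn : Fintype.card (Fin d × B) ≠ 0 := by
    have : Nonempty (Fin d) := ⟨⟨0, hd⟩⟩
    exact Fintype.card_ne_zero
  let e : Fin d × B ≃ Fin (Fintype.card (Fin d × B)) := Fintype.equivFin _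
  set n := Fintype.card (Fin d × B)
  obtain ⟨κ, hκ, hD⟩ := exists_isSubchannel_testDecoder e w
  refine ⟨assisted (maxEntangled n) (controlledEncoder e C) (testDecoder e w κ),
    ⟨n, n, maxEntangled n, controlledEncoder e C, testDecoder e w κ, isState_maxEntangled hn,
      isChannel_controlledEncoder e ?_ ?_, hD, fun _ _ => rfl⟩, ?_⟩
  · intro m g; simp only [C]; split_ifs <;> assumption
  · intro m g; simp only [C]; split_ifs <;> assumption
  set N' := assisted (maxEntangled n) (controlledEncoder e C) (testDecoder e w κ) N
  set q₁ := (testProb N w C₁).re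
  set q₂ := (testProb N w C₂).re
  have hq₂ : 0 ≤ q₂ := by
    have h : (testMap w () (ampliate B N C₂)).PosSemidef :=
      (isCP_testMap w ()).posSemidef (hN.1.ampliate_posSemidef h₂)
    have h' := (Complex.nonneg_iff.1 (h.diag_nonneg (i := ()))).1
    simpa [testMap, testProb, q₂] using h'
  have hN' : ∀ m k, (N' (Matrix.single m m 1) k k).re = κ * (n : ℝ)⁻¹ * if m = k then q₁ else q₂ := by
    intro m k
    have := congrArg Complex.re (assisted_controlledEncoder_apply e C w κ N m k)
    rw [this]
    have h : ((κ : ℂ) * (n : ℂ)⁻¹) = ((κ * (n : ℝ)⁻¹ : ℝ) : ℂ) := by push_cast; rfl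
    rw [h, Complex.re_ofReal_mul]
    simp only [C]
    split_ifs <;> rfl
  have hκn : 0 < κ * (n : ℝ)⁻¹ := by
    have : (0 : ℝ) < n := by exact_mod_cast Nat.pos_of_ne_zero hn
    positivity
  -- This is the error condition: message m yields outcome m with weight q₁ and each of the d - 1
  -- others with weight q₂, up to a common factor.
  have hlt' : (d - 1) * (1 - ε) * q₂ < ε * q₁ := by
    have := mul_lt_mul_of_pos_left hlt hε0
    rwa [← mul_assoc, mul_div_cancel₀ _ hε0.ne'] at this
  have hq₁ : 0 < q₁ := by
    have : 0 ≤ (d - 1) * (1 - ε) * q₂ := mul_nonneg (mul_nonneg hd' (by linarith)) hq₂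
    exact pos_of_mul_pos_right (this.trans_lt hlt') hε0.le
  have hsum : ∀ m : Fin d, ∑ k, (if m = k then q₁ else q₂) = q₁ + (d - 1) * q₂ := fun m => by
    rw [← Finset.add_sum_erase _ _ (Finset.mem_univ m), if_pos rfl,
      Finset.sum_congr rfl fun k hk => if_neg (Finset.ne_of_mem_erase hk).symm]
    simp [Finset.card_erase_of_mem, Nat.cast_sub hd]
  have : Nonempty (Fin d) := ⟨⟨0, hd⟩⟩
  have hinf : 1 - ε ≤ ⨅ m : Fin d, (Matrix.single m m 1 * N' (Matrix.single m m 1)).trace.re /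
      (N' (Matrix.single m m 1)).trace.re := by
    refine le_ciInf fun m => ?_
    have hs : (Matrix.single m m 1 * N' (Matrix.single m m 1)).trace.re = κ * (n : ℝ)⁻¹ * q₁ := by
      rw [Matrix.trace_single_mul, one_smul, hN', if_pos rfl]
    have ht : (N' (Matrix.single m m 1)).trace.re = κ * (n : ℝ)⁻¹ * (q₁ + (d - 1) * q₂) := by
      rw [Matrix.trace, Complex.re_sum]
      simp only [Matrix.diag_apply, hN']
      rw [← Finset.mul_sum, hsum]
    have hpos : 0 < q₁ + (d - 1) * q₂ := by positivity
    rw [hs, ht, mul_div_mul_left _ _ hκn.ne', le_div_iff₀ hpos]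
    nlinarith
  rw [errC]
  linarith

end Achievability

/-! ### Entanglement-assisted protocols are nonsignalling-assisted -/

section Inclusion

variable {A B A' B' M M' R S : Type*}

lemma isChannel_shareMap [Fintype A'] [Fintype B'] [Fintype M]
    {γ : Matrix (A' × B') (A' × B') ℂ} (hγ : IsState γ) : IsChannel (shareMap M γ) := by
  refine ⟨(isCP_submatrixMap _).comp (isCP_kroneckerRight hγ.1), fun X => ?_⟩
  have h := (isChannel_submatrixMap (A := M × A' × B') (B := B' × M × A')
    ⟨fun x => (x.2.1, x.2.2, x.1), fun x => (x.2.2, x.1, x.2.1), fun _ => rfl, fun _ => rfl⟩).2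
      (X ⊗ₖ γ)
  rw [Matrix.trace_kronecker, hγ.2, mul_one] at h
  exact h

/-- An assisted protocol acting on part of `N` is a composition of `N`, `D`, `E` and the shared
state, each tensored with identities, and of reorderings of factors; preservation of complete
positivity and of channels is then immediate. -/
lemma extend_assisted [Fintype R] [DecidableEq R] (γ : Matrix (A' × B') (A' × B') ℂ)
    (E : SuperOp (M × A') A) (D : SuperOp (B' × B) M') (N : SuperOp (R × A) (S × B)) :
    (assisted γ E D).extend N = ampliate S D ∘ₗ
      submatrixMap (fun x : S × B' × B => (x.2.1, x.1, x.2.2)) ∘ₗ ampliate B' N ∘ₗ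
      submatrixMap (fun x : B' × R × A => (x.2.1, x.1, x.2.2)) ∘ₗ
      ampliate R (ampliate B' E ∘ₗ shareMap M γ) := by
  ext1 X
  ext ⟨s, x⟩ ⟨s', x'⟩
  let F : SuperOp M (B' × A) := ampliate B' E ∘ₗ shareMap M γ
  have hL : (assisted γ E D).extend N X (s, x) (s', x') = D (∑ r, ∑ r',
      ampliate B' (component N r r' s s') (F (X.submatrix (Prod.mk r) (Prod.mk r')))) x x' := by
    simp only [map_sum, Matrix.sum_apply]
    rfl
  rw [hL]
  simp only [LinearMap.comp_apply]
  rw [ampliate_apply]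
  refine congrArg (fun Y => D Y x x') ?_
  ext ⟨y, b⟩ ⟨y', b'⟩
  have hW : (submatrixMap (fun x : B' × R × A => (x.2.1, x.1, x.2.2)) (ampliate R F X)).submatrix
      (Prod.mk y) (Prod.mk y') = ∑ r, ∑ r', Matrix.single r r' (1 : ℂ) ⊗ₖ
        (F (X.submatrix (Prod.mk r) (Prod.mk r'))).submatrix (Prod.mk y) (Prod.mk y') := by
    ext ⟨r, a⟩ ⟨r', a'⟩
    simp [Matrix.sum_apply, ampliate_apply, Matrix.single_apply, ite_and]
  change _ = N ((submatrixMap (fun x : B' × R × A => (x.2.1, x.1, x.2.2))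
    (ampliate R F X)).submatrix (Prod.mk y) (Prod.mk y')) (s, b) (s', b')
  rw [hW]
  simp only [map_sum, Matrix.sum_apply]
  rfl

lemma isChannel_leftComm [Fintype R] [Fintype A] [Fintype B] :
    IsChannel (submatrixMap fun x : R × A × B => (x.2.1, x.1, x.2.2)) :=
  isChannel_submatrixMap (A := A × R × B) (B := R × A × B)
    ⟨fun x => (x.2.1, x.1, x.2.2), fun x => (x.2.1, x.1, x.2.2), fun _ => rfl, fun _ => rfl⟩

lemma isSuperchannel_assisted [Fintype A] [Fintype B] [Fintype A'] [Fintype B'] [Fintype M]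
    [Fintype M'] {γ : Matrix (A' × B') (A' × B') ℂ} {E : SuperOp (M × A') A}
    {D : SuperOp (B' × B) M'} (hγ : IsState γ) (hE : IsChannel E) (hD : IsChannel D) :
    IsSuperchannel (assisted γ E D) := by
  have hF : IsChannel (ampliate B' E ∘ₗ shareMap M γ) := hE.ampliate.comp (isChannel_shareMap hγ)
  refine ⟨fun r s N hN => ?_, fun r s N hN => ?_⟩
  · rw [extend_assisted]
    exact hD.1.ampliate.comp ((isCP_submatrixMap _).comp (hN.ampliate.comp
      ((isCP_submatrixMap _).comp hF.1.ampliate)))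
  · rw [extend_assisted]
    exact hD.ampliate.comp (isChannel_leftComm.comp
      (hN.ampliate.comp (isChannel_leftComm.comp hF.ampliate)))

lemma traceSnd_withShared [Fintype A'] [Fintype M] (ρ : Matrix M M ℂ)
    (γ : Matrix (A' × B') (A' × B') ℂ) :
    traceSnd (withShared ρ γ) = ρ.trace • traceFst γ := by
  ext y y'
  simp [traceSnd, traceFst, withShared, Fintype.sum_prod_type, Matrix.trace, Finset.sum_mul,
    Finset.mul_sum]
  exact Finset.sum_comm

lemma isNA_assisted [Fintype A] [Fintype B] [DecidableEq B] [Fintype A'] [Fintype B'] [Fintype M]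
    [DecidableEq M] [Fintype M'] {γ : Matrix (A' × B') (A' × B') ℂ} {E : SuperOp (M × A') A}
    {D : SuperOp (B' × B) M'} (hγ : IsState γ) (hE : IsChannel E) (hD : IsChannel D) :
    IsNA (assisted γ E D) := by
  refine ⟨isSuperchannel_assisted hγ hE hD, fun ρ ω σ hρ hω _ => ?_⟩
  -- With the slot closed by a replacement map, Bob sees only his share of γ and σ, whatever Alice
  -- encodes.
  have h : ∀ ρ : Matrix M M ℂ, IsState ρ →
      assisted γ E D (traceMap σ) ρ = D (traceFst γ ⊗ₖ σ) := fun ρ hρ => by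
    rw [assisted_apply, ampliate_traceMap, traceSnd_ampliate E hE.2, traceSnd_withShared, hρ.2,
      one_smul]
  rw [traceFst_bipartite, traceFst_bipartite, h ρ hρ, h ω hω]

lemma isCP_functional_smul [Fintype A] [Finite B] {ψ : Matrix A A ℂ →ₗ[ℂ] ℂ}
    (hψ : ∀ X, X.PosSemidef → 0 ≤ (ψ X).re) (hψ' : ∀ X, ψ Xᴴ = star (ψ X))
    {Y : Matrix B B ℂ} (hY : Y.PosSemidef) : IsCP (ψ.smulRight Y) := by
  classical
  refine isCP_of_choi ?_
  have h := posSemidef_of_functional ψ fun T hT => by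
    have := hψ _ hT
    rw [map_add, hψ'] at this
    simp at this
    linarith
  exact h.kronecker hY

/-- Complete a subchannel to a channel, with a flag that tells success from failure. -/
def flagged [Fintype A] [Fintype B] (D : SuperOp A B) (τ : Matrix B B ℂ) :
    SuperOp A (B × Fin 2) :=
  kroneckerRight B (Matrix.single 0 0 1) ∘ₗ D +
    (Matrix.traceLinearMap A ℂ ℂ - Matrix.traceLinearMap B ℂ ℂ ∘ₗ D).smulRight
      (τ ⊗ₖ Matrix.single 1 1 1)

/-- The lost weight tr X - tr D[X] is a positive functional of X because D is trace nonincreasing;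
putting it on the failure flag restores the trace. -/
lemma isChannel_flagged [Fintype A] [Fintype B] {D : SuperOp A B} (hD : IsSubchannel D)
    {τ : Matrix B B ℂ} (hτ : IsState τ) : IsChannel (flagged D τ) := by
  refine ⟨((isCP_kroneckerRight (isState_single _).1).comp hD.1).add (isCP_functional_smul
    (fun X hX => ?_) (fun X => ?_) (hτ.1.kronecker (isState_single _).1)), fun X => ?_⟩
  · simpa using hD.2 X hX
  · simp [hD.1.map_conjTranspose, Matrix.trace_conjTranspose]
  · simp [flagged, Matrix.trace_add, Matrix.trace_kronecker, Matrix.trace_smul, hτ.2]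

lemma isSubchannel_flagSuccess [Fintype B] :
    IsSubchannel (submatrixMap fun b : B => (b, (0 : Fin 2))) := by
  refine ⟨isCP_submatrixMap _, fun X hX => ?_⟩
  simp only [submatrixMap_apply, Matrix.trace, Matrix.diag_apply, Matrix.submatrix_apply,
    Fintype.sum_prod_type, Complex.re_sum, Fin.sum_univ_two]
  exact Finset.sum_le_sum fun b _ =>
    le_add_of_nonneg_right (Complex.nonneg_iff.1 hX.diag_nonneg).1

lemma flagSuccess_flagged [Fintype A] [Fintype B] (D : SuperOp A B) (τ : Matrix B B ℂ)
    (X : Matrix A A ℂ) : submatrixMap (fun b : B => (b, (0 : Fin 2))) (flagged D τ X) = D X := by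
  ext b b'
  simp [flagged]

lemma pEA_subset_pNA [Fintype A] [Fintype B] [DecidableEq B] {d : ℕ} (hd : 1 ≤ d) :
    pEA A B d ⊆ pNA A B d := by
  rintro Θ ⟨a', b', γ, E, D, hγ, hE, hD, hΘ⟩
  -- The failure branch needs some state of the message system, which exists because d ≥ 1;
  -- postselecting on flag 0 recovers `D`.
  refine ⟨assisted γ E (flagged D (Matrix.single ⟨0, hd⟩ ⟨0, hd⟩ 1)), _,
    isNA_assisted hγ hE (isChannel_flagged hD (isState_single _)), isSubchannel_flagSuccess,
    fun N => LinearMap.ext fun ρ => ?_⟩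
  rw [hΘ, LinearMap.comp_apply, assisted_apply, flagSuccess_flagged]

end Inclusion

/-! ### Bounds on the capacities -/

section Capacity

variable {A B : Type*}

lemma lt_of_natCast_lt {Λ : ℝ≥0∞} {ε : ℝ} (hε0 : 0 < ε) (hε1 : ε < 1) {d : ℕ} (hd : 1 ≤ d)
    (h : (d : ℝ≥0∞) < ENNReal.ofReal (ε / (1 - ε)) * Λ + 1) :
    ENNReal.ofReal ((d - 1) * (1 - ε) / ε) < Λ := by
  have hε : 0 < 1 - ε := sub_pos.2 hε1
  induction Λ with
  | top => exact ENNReal.ofReal_lt_top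
  | coe x =>
    rw [← ENNReal.ofReal_coe_nnreal, ← ENNReal.ofReal_mul (by positivity), ← ENNReal.ofReal_one,
      ← ENNReal.ofReal_add (by positivity) zero_le_one, ← ENNReal.ofReal_natCast,
      ENNReal.ofReal_lt_ofReal_iff (by positivity)] at h
    have h' : (d - 1) * (1 - ε) / ε < (x : ℝ) := by
      rw [div_lt_iff₀ hε0]
      have : (d : ℝ) - 1 < ε / (1 - ε) * x := by linarith
      rw [div_mul_eq_mul_div, lt_div_iff₀ hε] at this
      linarith
    have hd' : (1 : ℝ) ≤ d := by exact_mod_cast hd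
    have hx : 0 < (x : ℝ) :=
      lt_of_le_of_lt (div_nonneg (mul_nonneg (by linarith) hε.le) hε0.le) h'
    rw [← ENNReal.ofReal_coe_nnreal]
    exact (ENNReal.ofReal_lt_ofReal_iff hx).2 h'

lemma le_of_forall_lt_ofReal {Λ : ℝ≥0∞} {ε : ℝ} (hε0 : 0 < ε) (hε1 : ε < 1) {d : ℕ}
    (h : ∀ l : ℝ, Λ < ENNReal.ofReal l → ((d : ℝ) - 1) * (1 - ε) ≤ ε * l) :
    (d : ℝ≥0∞) ≤ ENNReal.ofReal (ε / (1 - ε)) * Λ + 1 := by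
  have hε : 0 < 1 - ε := sub_pos.2 hε1
  induction Λ with
  | top => simp [ENNReal.mul_top, div_pos hε0 hε]
  | coe x =>
    have hx : ((d : ℝ) - 1) * (1 - ε) / ε ≤ x := le_of_forall_gt_imp_ge_of_dense fun l hl => by
      rw [div_le_iff₀ hε0, mul_comm l]
      refine h l ?_
      rw [← ENNReal.ofReal_coe_nnreal]
      exact (ENNReal.ofReal_lt_ofReal_iff (x.2.trans_lt hl)).2 hl
    rw [← ENNReal.ofReal_coe_nnreal, ← ENNReal.ofReal_mul (by positivity), ← ENNReal.ofReal_one,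
      ← ENNReal.ofReal_add (by positivity) zero_le_one, ← ENNReal.ofReal_natCast]
    refine ENNReal.ofReal_le_ofReal ?_
    have : (d : ℝ) - 1 ≤ ε / (1 - ε) * x := by
      rw [div_mul_eq_mul_div, le_div_iff₀ hε]
      rw [div_le_iff₀ hε0] at hx
      linarith
    linarith

lemma IsChannel.nonempty [Fintype A] [Nonempty A] [Fintype B] {N : SuperOp A B}
    (hN : IsChannel N) : Nonempty B := by
  classical
  by_contra h
  rw [not_nonempty_iff] at h
  obtain ⟨a⟩ := ‹Nonempty A›
  have := hN.2 (Matrix.single a a 1)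
  rw [Matrix.trace_single_eq_same] at this
  simp [Matrix.trace] at this

lemma log2_le_classicalCapacity_pEA [Fintype A] [Nonempty A] [Fintype B] {N : SuperOp A B}
    (hN : IsChannel N) {ε : ℝ} (hε0 : 0 < ε) (hε1 : ε < 1) {d : ℕ} (hd : 1 ≤ d)
    (h : (d : ℝ≥0∞) < ENNReal.ofReal (ε / (1 - ε)) * exp2 (channelProjectiveInfo N) + 1) :
    log2 d ≤ classicalCapacity (pEA A B) ε N := by
  have := hN.nonempty
  obtain ⟨Θ, hΘ, herr⟩ := exists_mem_pEA hN hε0 hε1 hd (by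
    rw [← log2_exp2 (channelProjectiveInfo N)]
    exact log2_strictMono (lt_of_natCast_lt hε0 hε1 hd h))
  exact le_iSup₂_of_le d hd (le_iSup₂_of_le Θ hΘ (le_iSup_of_le herr le_rfl))

lemma classicalCapacity_pNA_le [Fintype A] [Fintype B] [DecidableEq B] {N : SuperOp A B}
    (hN : IsChannel N) {ε : ℝ} (hε0 : 0 < ε) (hε1 : ε < 1) :
    classicalCapacity (pNA A B) ε N ≤
      log2 ((ENat.floor (ENNReal.ofReal (ε / (1 - ε)) * exp2 (channelProjectiveInfo N) + 1) : ℕ∞) :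
        ℝ≥0∞) := by
  refine iSup₂_le fun d hd => iSup₂_le fun Θ hΘ => iSup_le fun herr => log2_mono ?_
  rw [← ENat.toENNReal_coe, ENat.toENNReal_le, ENat.le_floor, ENat.toENNReal_coe]
  refine le_of_forall_lt_ofReal hε0 hε1 fun l hl => dim_le_of_mem_pNA hN hε1 hd hΘ herr ?_
  rw [← log2_exp2 (channelProjectiveInfo N)]
  exact log2_strictMono hl

lemma log2_ceil_sq_le {x : ℝ≥0∞} {c : EReal}
    (h : ∀ d : ℕ, 1 ≤ d → (d : ℝ≥0∞) < x → log2 d ≤ c) :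
    log2 (((ENat.ceil (x ^ (1 / 2 : ℝ) - 1) : ℕ∞) : ℝ≥0∞) ^ 2) ≤ c := by
  cases hk : ENat.ceil (x ^ (1 / 2 : ℝ) - 1) with
  | top =>
    have hx : x = ⊤ := by
      rw [ENat.ceil_eq_top, ENNReal.sub_eq_top_iff] at hk
      exact (ENNReal.rpow_eq_top_iff_of_pos (by norm_num)).1 hk.1
    -- If x is infinite, every dimension is admissible, so `c` is bounded below by `log2` of
    -- arbitrarily large integers.
    have hc : exp2 c = ⊤ := by
      refine ENNReal.eq_top_of_forall_nnreal_le fun r => ?_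
      obtain ⟨n, hn⟩ := exists_nat_ge r
      have := exp2_mono (h (n + 1) (Nat.succ_pos n) (hx ▸ ENNReal.natCast_lt_top _))
      rw [exp2_log2] at this
      refine le_trans ?_ this
      have : r ≤ ((n + 1 : ℕ) : NNReal) := hn.trans (by push_cast; exact le_add_of_nonneg_right zero_le_one)
      exact_mod_cast this
    rw [← log2_exp2 c, hc]
    exact log2_mono le_top
  | coe k =>
    rcases Nat.eq_zero_or_pos k with rfl | hk0
    · simp [log2, EReal.bot_div_of_pos_ne_top, Real.log_pos one_lt_two]
    -- From k - 1 < √x - 1 follows k < √x, so d = k² satisfies the strict inequality d < x required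
    -- by `h`.
    · have h₁ : ((k - 1 : ℕ) : ℕ∞) < ENat.ceil (x ^ (1 / 2 : ℝ) - 1) := by
        rw [hk]; exact_mod_cast Nat.sub_lt hk0 one_pos
      rw [ENat.lt_ceil, lt_tsub_iff_right, ENat.toENNReal_coe] at h₁
      have h₂ : (k : ℝ≥0∞) < x ^ (1 / 2 : ℝ) := by
        convert h₁ using 1
        exact_mod_cast (Nat.sub_add_cancel hk0).symm
      rw [one_div, ENNReal.lt_rpow_inv_iff two_pos] at h₂
      have h₃ : (k : ℝ≥0∞) ^ 2 < x := by exact_mod_cast h₂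
      have := h (k ^ 2) (Nat.one_le_pow _ _ hk0) (by push_cast; exact h₃)
      simpa using this

end Capacity

end Postselected

end

theorem theorem2 {A B : Type*} [Fintype A] [Nonempty A] [Fintype B] [DecidableEq B]
    (N : Postselected.SuperOp A B) (hN : Postselected.IsChannel N)
    (ε : ℝ) (hε0 : 0 < ε) (hε1 : ε < 1) :
    Postselected.log2
        (((ENat.ceil ((ENNReal.ofReal (ε / (1 - ε)) *
            Postselected.exp2 (Postselected.channelProjectiveInfo N) + 1) ^ (1 / 2 : ℝ) - 1) : ℕ∞) :
              ℝ≥0∞) ^ 2)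
      ≤ Postselected.classicalCapacity (Postselected.pEA A B) ε N ∧
    Postselected.classicalCapacity (Postselected.pEA A B) ε N
      ≤ Postselected.classicalCapacity (Postselected.pNA A B) ε N ∧
    Postselected.classicalCapacity (Postselected.pNA A B) ε N
      ≤ Postselected.log2
        ((ENat.floor (ENNReal.ofReal (ε / (1 - ε)) *
            Postselected.exp2 (Postselected.channelProjectiveInfo N) + 1) : ℕ∞) : ℝ≥0∞) := by
  refine ⟨Postselected.log2_ceil_sq_le fun d hd h =>
    Postselected.log2_le_classicalCapacity_pEA hN hε0 hε1 hd h, ?_,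
    Postselected.classicalCapacity_pNA_le hN hε0 hε1⟩
  exact iSup₂_mono fun d hd => iSup₂_mono' fun Θ hΘ =>
    ⟨Θ, Postselected.pEA_subset_pNA hd hΘ, le_rfl⟩
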